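/- Let $H$ be a real Hilbert space and let $A$, $G$ be linear maximal monotone operators on $H$ (that is, $\langle Tx,x\rangle\ge 0$ for all $x$ in the domain of $T$, and $I+T$ has range $H$, for $T=A$ and $T=G$). Let $S_A$ be the strongly continuous semigroup of contractions on $H$ generated by $-A$. For an integer $k\ge 1$ let $\mathsf D(G^k)$ be the domain of $G^k$, endowed with the scalar product $\langle\phi,\psi\rangle_{\mathsf D(G^k)}=\sum_{j=0}^{k}\langle G^j\phi,G^j\psi\rangle$. Assume that, for every $\varepsilon\in(0,1]$, the closure of $A+\varepsilon G$ (defined on $\mathsf D(A)\cap\mathsf D(G)$) is maximal monotone, and that there are an integer $m\ge 1$ and real constants $\alpha_1,\dots,\alpha_{m+1}$ such that, for every $k\in\{1,\dots,m+1\}$, all $\phi\in\mathsf D(G^k)$ and all $t\ge 0$, one has $S_A(t)\phi\in\mathsf D(G^k)$ and \[ \|G^kS_A(t)\phi\|\le e^{\alpha_k t}\|G^k\phi\|. \] For $\lambda>0$ put $R_\lambda(0)=(\lambda+A)^{-1}$ and, for $\varepsilon\in(0,1]$, $R_\lambda(\varepsilon)=(\lambda+\overline{A+\varepsilon G})^{-1}$,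 where $\overline{A+\varepsilon G}$ is the closure of $A+\varepsilon G$. (i) For every $\lambda>0$ with $\lambda>\alpha_1$, every $\varepsilon\in[0,1]$ and every $x\in H$, $R_\lambda(\varepsilon+h)x\to R_\lambda(\varepsilon)x$ in $H$ as $h\to 0$ with $\varepsilon+h\in[0,1]$. (ii) For every $k\in\{1,\dots,m\}$ and every $\lambda>0$ with $\lambda>\max(\alpha_k,\alpha_{k+1})$, the operator $R_\lambda(\delta)$ maps $\mathsf D(G^k)$ into itself for every $\delta\in[0,1]$, and, for every $\varepsilon\in[0,1]$ and every $x\in\mathsf D(G^k)$, $R_\lambda(\varepsilon+h)x\to R_\lambda(\varepsilon)x$ in $\mathsf D(G^k)$ as $h\to 0$ with $\varepsilon+h\in[0,1]$. -/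

import Mathlib

open Filter Topology Set

namespace MonotoneOp

section Operators

variable {H : Type*} [NormedAddCommGroup H] [InnerProductSpace ℝ H]

/-- A linear (possibly unbounded) operator `T` on the real Hilbert space `H` is maximal monotone:
`⟨T x, x⟩ ≥ 0` for all `x` in the domain, and the range of `I + T` is all of `H`. -/
structure IsMaximalMonotone (T : H →ₗ.[ℝ] H) : Prop where
  monotone : ∀ x : T.domain, 0 ≤ inner ℝ (T x) (x : H)
  range_eq_top : ∀ y : H, ∃ x : T.domain, (x : H) + T x = y

/-- The resolvent `(l + T)⁻¹`: `resolvent T l x` is the solution `y` in the domain of `T` of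
`l y + T y = x` (and `0` if there is none). For `T` maximal monotone and `l > 0` there is exactly
one such `y`, see `IsMaximalMonotone.existsUnique` below. -/
noncomputable def resolvent (T : H →ₗ.[ℝ] H) (l : ℝ) (x : H) : H :=
  open Classical in
  if h : ∃ y : T.domain, l • (y : H) + T y = x then (h.choose : H) else 0

/-- `S` (restricted to times `t ≥ 0`) is a strongly continuous semigroup of linear contractions. -/
structure IsContractionSemigroup (S : ℝ → H →L[ℝ] H) : Prop where
  zero : S 0 = ContinuousLinearMap.id ℝ H
  add : ∀ s t : ℝ, 0 ≤ s → 0 ≤ t → S (s + t) = (S s).comp (S t)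
  contraction : ∀ t : ℝ, 0 ≤ t → ‖S t‖ ≤ 1
  continuous : ∀ x : H, ContinuousOn (fun t => S t x) (Ici 0)

/-- The infinitesimal generator of `S` is exactly `-T`: a vector `x` is in the domain of `T` with
`T x = y` if and only if `(x - S t x) / t` converges to `y` as `t` decreases to `0`. -/
def HasGeneratorNeg (S : ℝ → H →L[ℝ] H) (T : H →ₗ.[ℝ] H) : Prop :=
  ∀ x y : H, (x, y) ∈ T.graph ↔ Tendsto (fun t : ℝ => t⁻¹ • (x - S t x)) (𝓝[>] 0) (𝓝 y)

/-- The strongly continuous semigroup of contractions generated by `-T` (which exists, and is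
unique on `t ≥ 0`, for every maximal monotone `T`; the value is `0` if there is none). -/
noncomputable def semigroup (T : H →ₗ.[ℝ] H) : ℝ → H →L[ℝ] H :=
  open Classical in
  if h : ∃ S : ℝ → H →L[ℝ] H, IsContractionSemigroup S ∧ HasGeneratorNeg S T then h.choose else 0

/-- The composition `g ∘ f` on its natural domain `{x ∈ D(f) : f x ∈ D(g)}`. -/
def pcomp (g f : H →ₗ.[ℝ] H) : H →ₗ.[ℝ] H where
  domain := (g.domain.comap f.toFun).map f.domain.subtype
  toFun :=
    { toFun := fun x => g ⟨f ⟨x, by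
          obtain ⟨y, -, hy⟩ := x.2; rw [← hy]; exact y.2⟩, by
          obtain ⟨_, y, hy, rfl⟩ := x; exact hy⟩
      map_add' := by
        rintro ⟨_, x, hx, rfl⟩ ⟨_, y, hy, rfl⟩
        rw [← g.map_add]
        congr 1
        exact Subtype.ext (f.map_add x y)
      map_smul' := by
        rintro c ⟨_, x, hx, rfl⟩
        rw [RingHom.id_apply, ← g.map_smul]
        congr 1
        exact Subtype.ext (f.map_smul c x) }

theorem mem_pcomp_domain {g f : H →ₗ.[ℝ] H} {x : H} :
    x ∈ (pcomp g f).domain ↔ ∃ hx : x ∈ f.domain, f ⟨x, hx⟩ ∈ g.domain := by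
  constructor
  · rintro ⟨y, hy, rfl⟩
    exact ⟨y.2, hy⟩
  · rintro ⟨hx, h⟩
    exact ⟨⟨x, hx⟩, h, rfl⟩

/-- The powers `G ^ k` on their natural domains: `G ^ 0` is the identity on `H`, and
`G ^ (k + 1) = G ∘ G ^ k` on `{x ∈ D(G ^ k) : G ^ k x ∈ D(G)}`. -/
def opPow (G : H →ₗ.[ℝ] H) : ℕ → (H →ₗ.[ℝ] H)
  | 0 => (LinearMap.id : H →ₗ[ℝ] H).toPMap ⊤
  | k + 1 => pcomp G (opPow G k)

theorem opPow_domain_anti (G : H →ₗ.[ℝ] H) : Antitone fun k => (opPow G k).domain :=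
  antitone_nat_of_succ_le fun _ _ hx => (mem_pcomp_domain.1 hx).1

/-- The domain `D(G ^ k)`, to be equipped with its own inner product. -/
def PowDomain (G : H →ₗ.[ℝ] H) (k : ℕ) : Type _ := (opPow G k).domain

namespace PowDomain

variable {G : H →ₗ.[ℝ] H} {k : ℕ}

instance : AddCommGroup (PowDomain G k) := inferInstanceAs (AddCommGroup (opPow G k).domain)

instance : Module ℝ (PowDomain G k) := inferInstanceAs (Module ℝ (opPow G k).domain)

/-- A vector of `H` that lies in `D(G ^ k)`, as an element of `D(G ^ k)`. -/
def mk (x : H) (hx : x ∈ (opPow G k).domain) : PowDomain G k := ⟨x, hx⟩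

/-- The linear map `x ↦ G ^ j x` on `D(G ^ k)`, for `j ∈ {0, …, k}`. -/
def powMap (j : Fin (k + 1)) : PowDomain G k →ₗ[ℝ] H :=
  (opPow G j).toFun.comp (Submodule.inclusion (opPow_domain_anti G (Nat.lt_succ_iff.1 j.2)))

/-- The inner product `⟨x, y⟩ + ⟨G x, G y⟩ + ⋯ + ⟨G ^ k x, G ^ k y⟩` on `D(G ^ k)`. -/
@[reducible] noncomputable def core (G : H →ₗ.[ℝ] H) (k : ℕ) :
    InnerProductSpace.Core ℝ (PowDomain G k) where
  inner x y := ∑ j : Fin (k + 1), inner ℝ (powMap j x) (powMap j y)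
  conj_inner_symm x y := by
    simp only [conj_trivial]
    exact Finset.sum_congr rfl fun j _ => real_inner_comm _ _
  re_inner_nonneg x := by
    simp only [RCLike.re_to_real]
    exact Finset.sum_nonneg fun j _ => real_inner_self_nonneg
  add_left x y z := by
    simp only [map_add, inner_add_left, Finset.sum_add_distrib]
  smul_left x y r := by
    simp only [map_smul, real_inner_smul_left, Finset.mul_sum, conj_trivial]
  definite x hx := by
    have h := (Finset.sum_eq_zero_iff_of_nonneg
      (fun j (_ : j ∈ Finset.univ) => real_inner_self_nonneg (x := powMap j x))).1 hx 0
      (Finset.mem_univ _)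
    exact Subtype.ext (inner_self_eq_zero.1 h)

noncomputable instance : NormedAddCommGroup (PowDomain G k) := (core G k).toNormedAddCommGroup

noncomputable instance : InnerProductSpace ℝ (PowDomain G k) :=
  InnerProductSpace.ofCore (core G k).toCore

end PowDomain

/-- The closure of `A + ε G`, where `A + ε G` is defined on `D(A) ∩ D(G)`. -/
noncomputable def closedSum (A G : H →ₗ.[ℝ] H) (ε : ℝ) : H →ₗ.[ℝ] H := (A + ε • G).closure

/-- `R_l(ε)`, the resolvent at `l` of (the closure of) `A + ε G` if `ε ≠ 0`, and of `A` if
`ε = 0`. -/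
noncomputable def perturbedResolvent (A G : H →ₗ.[ℝ] H) (l ε : ℝ) : H → H :=
  open Classical in
  if ε = 0 then resolvent A l else resolvent (closedSum A G ε) l

/-- The standing assumption on the interplay of `A` and `G`: the closure of `A + ε G` is maximal
monotone for every `ε ∈ (0, 1]`, and, for `k = 1, …, m + 1`, the semigroup generated by `-A` maps
`D(G ^ k)` to itself with `‖G ^ k S_A(t) x‖ ≤ exp (α_k t) ‖G ^ k x‖`. -/
structure StandingAssumption (A G : H →ₗ.[ℝ] H) (m : ℕ) (α : ℕ → ℝ) : Prop where
  maximalMonotone : ∀ ε ∈ Ioc (0 : ℝ) 1, IsMaximalMonotone (closedSum A G ε)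
  bound : ∀ k ∈ Icc 1 (m + 1), ∀ x : (opPow G k).domain, ∀ t : ℝ, 0 ≤ t →
    ∃ hx : semigroup A t (x : H) ∈ (opPow G k).domain,
      ‖opPow G k ⟨semigroup A t (x : H), hx⟩‖ ≤ Real.exp (α k * t) * ‖opPow G k x‖

end Operators

/-! ### The resolvents of a maximal monotone operator are everywhere defined -/

section Existence

variable {H : Type*} [NormedAddCommGroup H] [InnerProductSpace ℝ H]

theorem IsMaximalMonotone.norm_le {T : H →ₗ.[ℝ] H} (hT : IsMaximalMonotone T) {l : ℝ}
    (x : T.domain) : l * ‖(x : H)‖ ≤ ‖l • (x : H) + T x‖ := by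
  rcases eq_or_lt_of_le (norm_nonneg (x : H)) with h | h
  · rw [← h, mul_zero]
    exact norm_nonneg _
  · have h1 := real_inner_le_norm (l • (x : H) + T x) (x : H)
    rw [inner_add_left, real_inner_smul_left, real_inner_self_eq_norm_sq] at h1
    have h2 := hT.monotone x
    nlinarith

theorem IsMaximalMonotone.eq_of_eq {T : H →ₗ.[ℝ] H} (hT : IsMaximalMonotone T) {l : ℝ}
    (hl : 0 < l) {x y : T.domain} (h : l • (x : H) + T x = l • (y : H) + T y) : x = y := by
  have h1 := hT.norm_le (l := l) (x - y)
  have h2 : l • ((x - y : T.domain) : H) + T (x - y) = 0 := by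
    rw [T.map_sub, Submodule.coe_sub, smul_sub, sub_add_sub_comm, h, sub_self]
  rw [h2, norm_zero] at h1
  have h3 : ‖((x - y : T.domain) : H)‖ = 0 := by
    nlinarith [norm_nonneg ((x - y : T.domain) : H)]
  exact sub_eq_zero.1 (Subtype.ext (norm_eq_zero.1 h3))

theorem IsMaximalMonotone.step [CompleteSpace H] {T : H →ₗ.[ℝ] H} (hT : IsMaximalMonotone T)
    {l m : ℝ} (hl : 0 < l) (hm : 0 < m) (hml : m < 2 * l)
    (h : ∀ y : H, ∃ x : T.domain, l • (x : H) + T x = y) (y : H) :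
    ∃ x : T.domain, m • (x : H) + T x = y := by
  choose R hR using h
  have hlip : LipschitzWith (Real.toNNReal (|l - m| / l))
      fun z : H => ((R (y + (l - m) • z) : T.domain) : H) := by
    refine LipschitzWith.of_dist_le_mul fun z w => ?_
    rw [Real.coe_toNNReal _ (by positivity), dist_eq_norm, dist_eq_norm]
    have h1 := hT.norm_le (l := l) (R (y + (l - m) • z) - R (y + (l - m) • w))
    have h2 : l • ((R (y + (l - m) • z) - R (y + (l - m) • w) : T.domain) : H)
        + T (R (y + (l - m) • z) - R (y + (l - m) • w)) = (l - m) • (z - w) := by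
      rw [T.map_sub, Submodule.coe_sub, smul_sub, sub_add_sub_comm, hR, hR, smul_sub]
      abel
    rw [h2, norm_smul, Real.norm_eq_abs, Submodule.coe_sub] at h1
    rw [div_mul_eq_mul_div, le_div_iff₀ hl]
    linarith
  have hc : ContractingWith (Real.toNNReal (|l - m| / l))
      fun z : H => ((R (y + (l - m) • z) : T.domain) : H) := by
    refine ⟨?_, hlip⟩
    rw [Real.toNNReal_lt_one, div_lt_one hl, abs_lt]
    constructor <;> linarith
  have hfix := hc.fixedPoint_isFixedPt
  set z := ContractingWith.fixedPoint _ hc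
  have hz : ((R (y + (l - m) • z) : T.domain) : H) = z := hfix
  refine ⟨R (y + (l - m) • z), ?_⟩
  have h3 := hR (y + (l - m) • z)
  rw [hz] at h3 ⊢
  rw [sub_smul] at h3
  have h4 : T (R (y + (l • z - m • z))) = T (R (y + (l - m) • z)) := by rw [sub_smul]
  rw [h4] at h3
  have h5 : T (R (y + (l - m) • z)) = y + (l • z - m • z) - l • z := by rw [← h3]; abel
  rw [h5]
  abel

/-- For `T` maximal monotone and `l > 0`, the equation `l y + T y = x` has exactly one solution for
every `x`. -/
theorem IsMaximalMonotone.existsUnique [CompleteSpace H] {T : H →ₗ.[ℝ] H}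
    (hT : IsMaximalMonotone T) {l : ℝ} (hl : 0 < l) (x : H) :
    ∃! y : T.domain, l • (y : H) + T y = x := by
  have key : ∀ n : ℕ, ∀ l : ℝ, 0 < l → l < (3 / 2 : ℝ) ^ n →
      ∀ x : H, ∃ y : T.domain, l • (y : H) + T y = x := by
    intro n
    induction n with
    | zero =>
      intro l hl hl1 x
      refine hT.step one_pos hl (by rw [pow_zero] at hl1; linarith) (fun y => ?_) x
      obtain ⟨z, hz⟩ := hT.range_eq_top y
      exact ⟨z, by rw [one_smul]; exact hz⟩
    | succ n ih =>
      intro l hl hl1 x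
      rw [pow_succ] at hl1
      exact hT.step (l := 2 / 3 * l) (by linarith) hl (by linarith)
        (ih _ (by linarith) (by linarith)) x
  obtain ⟨n, hn⟩ := pow_unbounded_of_one_lt l (by norm_num : (1 : ℝ) < 3 / 2)
  obtain ⟨y, hy⟩ := key n l hl hn x
  exact ⟨y, hy, fun z hz => hT.eq_of_eq hl (hz.trans hy.symm)⟩

end Existence

end MonotoneOp

open MonotoneOp

/-! The core is a bound uniform in `ε`: the resolvent `R_l(ε)` sends vectors with `‖G ^ k x‖ ≤ C` to
vectors with `‖G ^ k y‖ ≤ C / (l - α k)`. For `ε = 0`, `A` is replaced by the bounded operator `(1 -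
S t) / t`; for `ε > 0`, `G` in the sum is replaced by its Yosida approximation, which involves only
the contraction `(1 + h G)⁻¹`, and this commutes with `G ^ k`. In both cases the approximate
equation is a fixed point equation whose Picard iterates stay in a fixed ball of `D(G ^ k)`. The
bound survives the limit because such balls (`powBall`) are closed in `H` (`resolvent_mem_powBall`,
`resolvent_closedSum_mem_powBall`).

For (i), if `y` lies in `D(A) ∩ D(G)` then `R_l(δ) x - y` is controlled by the residual `x - (l + A
+ ε G) y` and by `|δ - ε| ‖G y‖`. So continuity at `ε` follows once the residual can be made
arbitrarily small. For `ε > 0` this is the definition of the closure; for `ε = 0` it holds because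
`R_l(0)` preserves the dense subspace `D(G)`, by the uniform bound for `k = 1`.

For (ii), `x` is replaced by `x' = (1 + h G)⁻¹ x`, which lies in `D(G ^ (k + 1))`; the error is
small in `D(G ^ k)` uniformly in `ε`. The vectors `R_l(δ) x'` are bounded in `D(G ^ (k + 1))` and
converge in `H`, so the interpolation inequality `exists_interpolation` makes `G ^ k R_l(δ) x'`
converge. The same inequality bounds the intermediate powers in the norm of `D(G ^ k)`. -/

namespace MonotoneOp

/-! ### Resolvents and Yosida approximations of a maximal monotone operator. -/

section Resolvent

variable {H : Type*} [NormedAddCommGroup H] [InnerProductSpace ℝ H]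

theorem IsMaximalMonotone.inner_nonneg {T : H →ₗ.[ℝ] H} (hT : IsMaximalMonotone T) {x y : H}
    (h : (x, y) ∈ T.graph) : 0 ≤ inner ℝ y x := by
  obtain ⟨z, rfl, rfl⟩ := T.mem_graph_iff.1 h
  exact hT.monotone z

theorem IsMaximalMonotone.mul_norm_le {T : H →ₗ.[ℝ] H} (hT : IsMaximalMonotone T) {l : ℝ}
    {x y : H} (h : (x, y) ∈ T.graph) : l * ‖x‖ ≤ ‖l • x + y‖ := by
  obtain ⟨z, rfl, rfl⟩ := T.mem_graph_iff.1 h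
  exact hT.norm_le z

/-- For density arguments: a contraction moves `x` hardly more than it moves a nearby, more regular
`w`. -/
theorem norm_sub_add_norm_le_of_approx {J : H →L[ℝ] H} (hJ : ∀ x, ‖J x‖ ≤ ‖x‖) (x w : H) :
    ‖J x - x‖ ≤ 2 * ‖x - w‖ + ‖J w - w‖ := by
  have h : J x - x = J (x - w) - (x - w) + (J w - w) := by rw [map_sub]; abel
  rw [h]
  have h1 := norm_add_le (J (x - w) - (x - w)) (J w - w)
  have h2 := norm_sub_le (J (x - w)) (x - w)
  linarith [hJ (x - w)]

theorem inner_sub_self_nonneg_of_norm_le {K : H →L[ℝ] H} (hK : ∀ x, ‖K x‖ ≤ ‖x‖) (x : H) :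
    0 ≤ inner ℝ (x - K x) x := by
  rw [inner_sub_left, real_inner_self_eq_norm_sq]
  have h1 := real_inner_le_norm (K x) x
  nlinarith [hK x, norm_nonneg x]

variable [CompleteSpace H]

theorem IsMaximalMonotone.resolvent_mem_graph {T : H →ₗ.[ℝ] H} (hT : IsMaximalMonotone T) {l : ℝ}
    (hl : 0 < l) (x : H) : (resolvent T l x, x - l • resolvent T l x) ∈ T.graph := by
  have h : ∃ y : T.domain, l • (y : H) + T y = x := (hT.existsUnique hl x).exists
  rw [resolvent, dif_pos h]
  have h1 := T.mem_graph h.choose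
  rwa [eq_sub_of_add_eq' h.choose_spec] at h1

theorem IsMaximalMonotone.resolvent_eq {T : H →ₗ.[ℝ] H} (hT : IsMaximalMonotone T) {l : ℝ}
    (hl : 0 < l) {x y : H} (h : (x, y) ∈ T.graph) : resolvent T l (l • x + y) = x := by
  have h0 : (resolvent T l (l • x + y) - x, l • x + y - l • resolvent T l (l • x + y) - y) ∈
      T.graph := sub_mem (hT.resolvent_mem_graph hl (l • x + y)) h
  have h1 := hT.mul_norm_le (l := l) h0
  have h2 : l • (resolvent T l (l • x + y) - x)
      + (l • x + y - l • resolvent T l (l • x + y) - y) = 0 := by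
    rw [smul_sub]; abel
  rw [h2, norm_zero] at h1
  exact sub_eq_zero.1 (norm_le_zero_iff.1 (by nlinarith))

theorem IsMaximalMonotone.norm_resolvent_le {T : H →ₗ.[ℝ] H} (hT : IsMaximalMonotone T) {l : ℝ}
    (hl : 0 < l) (x : H) : ‖resolvent T l x‖ ≤ l⁻¹ * ‖x‖ := by
  have h := hT.mul_norm_le (l := l) (hT.resolvent_mem_graph hl x)
  rw [add_sub_cancel] at h
  rwa [inv_mul_eq_div, le_div_iff₀' hl]

/-- The resolvent `(l + T)⁻¹` of a maximal monotone operator as a bounded operator. -/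
noncomputable def IsMaximalMonotone.resolventCLM {T : H →ₗ.[ℝ] H} (hT : IsMaximalMonotone T)
    {l : ℝ} (hl : 0 < l) : H →L[ℝ] H :=
  LinearMap.mkContinuous
    { toFun := resolvent T l
      map_add' := fun x y => by
        have h : (resolvent T l x + resolvent T l y,
            x - l • resolvent T l x + (y - l • resolvent T l y)) ∈ T.graph :=
          add_mem (hT.resolvent_mem_graph hl x) (hT.resolvent_mem_graph hl y)
        rw [← hT.resolvent_eq hl h]
        congr 1
        rw [smul_add]; abel
      map_smul' := fun c x => by
        have h : (c • resolvent T l x, c • (x - l • resolvent T l x)) ∈ T.graph :=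
          T.graph.smul_mem c (hT.resolvent_mem_graph hl x)
        rw [RingHom.id_apply, ← hT.resolvent_eq hl h]
        congr 1
        rw [smul_sub, smul_comm l c]; abel }
    l⁻¹ (hT.norm_resolvent_le hl)

@[simp]
theorem IsMaximalMonotone.resolventCLM_apply {T : H →ₗ.[ℝ] H} (hT : IsMaximalMonotone T)
    {l : ℝ} (hl : 0 < l) (x : H) : hT.resolventCLM hl x = resolvent T l x := rfl

/-- With `J = (1 + T)⁻¹`, the graph is the set where the continuous maps `J (x + y)` and `x` agree.
-/
theorem IsMaximalMonotone.isClosed_graph {T : H →ₗ.[ℝ] H} (hT : IsMaximalMonotone T) :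
    IsClosed (T.graph : Set (H × H)) := by
  have : (T.graph : Set (H × H))
      = {p : H × H | hT.resolventCLM one_pos ((1 : ℝ) • p.1 + p.2) = p.1} := by
    ext ⟨x, y⟩
    constructor
    · intro h
      exact hT.resolvent_eq one_pos h
    · intro h
      have h1 := hT.resolvent_mem_graph one_pos ((1 : ℝ) • x + y)
      have h2 : resolvent T 1 ((1 : ℝ) • x + y) = x := h
      rwa [h2, add_sub_cancel_left] at h1
  rw [this]
  exact isClosed_eq (by fun_prop) (by fun_prop)

/-- Write a vector orthogonal to the domain as `z + T z`. Pairing it with `z` gives `‖z‖ ^ 2 + ⟨T z,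
z⟩ = 0`, so `z = 0`. -/
theorem IsMaximalMonotone.dense_domain {T : H →ₗ.[ℝ] H} (hT : IsMaximalMonotone T) :
    Dense (T.domain : Set H) := by
  rw [Submodule.dense_iff_topologicalClosure_eq_top, Submodule.topologicalClosure_eq_top_iff,
    Submodule.eq_bot_iff]
  intro v hv
  obtain ⟨z, rfl⟩ := hT.range_eq_top v
  have h1 := (Submodule.mem_orthogonal' _ _).1 hv z z.2
  rw [inner_add_left, real_inner_self_eq_norm_sq] at h1
  have h2 := hT.monotone z
  have h3 : ‖(z : H)‖ = 0 := by nlinarith [norm_nonneg (z : H)]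
  have h4 : z = 0 := Subtype.ext (norm_eq_zero.1 h3)
  rw [h4, T.map_zero, Submodule.coe_zero, add_zero]

/-- The contraction `(1 + h T)⁻¹`. -/
noncomputable def IsMaximalMonotone.contr {T : H →ₗ.[ℝ] H} (hT : IsMaximalMonotone T)
    {h : ℝ} (hh : 0 < h) : H →L[ℝ] H := h⁻¹ • hT.resolventCLM (inv_pos.2 hh)

/-- The Yosida approximation `T (1 + h T)⁻¹ = h⁻¹ (1 - (1 + h T)⁻¹)`. -/
noncomputable def IsMaximalMonotone.yosida {T : H →ₗ.[ℝ] H} (hT : IsMaximalMonotone T)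
    {h : ℝ} (hh : 0 < h) : H →L[ℝ] H := h⁻¹ • (ContinuousLinearMap.id ℝ H - hT.contr hh)

theorem IsMaximalMonotone.yosida_apply {T : H →ₗ.[ℝ] H} (hT : IsMaximalMonotone T)
    {h : ℝ} (hh : 0 < h) (x : H) : hT.yosida hh x = h⁻¹ • (x - hT.contr hh x) := rfl

theorem IsMaximalMonotone.contr_mem_graph {T : H →ₗ.[ℝ] H} (hT : IsMaximalMonotone T)
    {h : ℝ} (hh : 0 < h) (x : H) : (hT.contr hh x, hT.yosida hh x) ∈ T.graph := by
  have h1 := T.graph.smul_mem h⁻¹ (hT.resolvent_mem_graph (inv_pos.2 hh) x)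
  exact h1

theorem IsMaximalMonotone.contr_eq {T : H →ₗ.[ℝ] H} (hT : IsMaximalMonotone T)
    {h : ℝ} (hh : 0 < h) {x y : H} (hxy : (x, y) ∈ T.graph) : hT.contr hh (x + h • y) = x := by
  have h1 := hT.resolvent_eq (inv_pos.2 hh) (T.graph.smul_mem h hxy)
  simp only [inv_smul_smul₀ hh.ne'] at h1
  change h⁻¹ • resolvent T h⁻¹ (x + h • y) = x
  rw [h1, inv_smul_smul₀ hh.ne']

theorem IsMaximalMonotone.norm_contr_le {T : H →ₗ.[ℝ] H} (hT : IsMaximalMonotone T)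
    {h : ℝ} (hh : 0 < h) (x : H) : ‖hT.contr hh x‖ ≤ ‖x‖ := by
  change ‖h⁻¹ • resolvent T h⁻¹ x‖ ≤ ‖x‖
  have h1 := hT.norm_resolvent_le (inv_pos.2 hh) x
  rw [inv_inv] at h1
  rw [norm_smul, norm_inv, Real.norm_of_nonneg hh.le, inv_mul_eq_div, div_le_iff₀' hh]
  exact h1

/-- The contraction `J = (1 + h T)⁻¹` commutes with `T`: apply `J` linearly in `x = J (x + h y)` and
compare with `T J x = h⁻¹ (x - J x)`. -/
theorem IsMaximalMonotone.contr_mem_graph_of_mem {T : H →ₗ.[ℝ] H} (hT : IsMaximalMonotone T)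
    {h : ℝ} (hh : 0 < h) {x y : H} (hxy : (x, y) ∈ T.graph) :
    (hT.contr hh x, hT.contr hh y) ∈ T.graph := by
  have h1 := hT.contr_mem_graph hh x
  have h2 := hT.contr_eq hh hxy
  rw [map_add, map_smul] at h2
  have h3 : hT.yosida hh x = hT.contr hh y := by
    rw [hT.yosida_apply]
    nth_rewrite 1 [← h2]
    rw [add_sub_cancel_left, inv_smul_smul₀ hh.ne']
  rwa [h3] at h1

theorem IsMaximalMonotone.yosida_eq_contr {T : H →ₗ.[ℝ] H} (hT : IsMaximalMonotone T)
    {h : ℝ} (hh : 0 < h) {x y : H} (hxy : (x, y) ∈ T.graph) :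
    hT.yosida hh x = hT.contr hh y :=
  T.mem_graph_snd_inj (hT.contr_mem_graph hh x) (hT.contr_mem_graph_of_mem hh hxy) rfl

theorem IsMaximalMonotone.contr_comm {T : H →ₗ.[ℝ] H} (hT : IsMaximalMonotone T)
    {h k : ℝ} (hh : 0 < h) (hk : 0 < k) (x : H) :
    hT.contr hh (hT.contr hk x) = hT.contr hk (hT.contr hh x) := by
  have h1 := hT.contr_eq hh (hT.contr_mem_graph_of_mem hk (hT.contr_mem_graph hh x))
  rw [← h1, ← map_smul, ← map_add, hT.yosida_apply, smul_inv_smul₀ hh.ne', add_sub_cancel]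

theorem IsMaximalMonotone.exists_norm_contr_sub_lt {T : H →ₗ.[ℝ] H} (hT : IsMaximalMonotone T)
    (x : H) {η : ℝ} (hη : 0 < η) :
    ∃ δ > 0, ∀ (h : ℝ) (hh : 0 < h), h < δ → ‖hT.contr hh x - x‖ < η := by
  obtain ⟨w, hw, hxw⟩ := Metric.mem_closure_iff.1 (hT.dense_domain x) (η / 4) (by linarith)
  obtain ⟨y, hy⟩ := LinearPMap.mem_domain_iff.1 hw
  rw [dist_eq_norm] at hxw
  refine ⟨η / 2 / (‖y‖ + 1), by positivity, fun h hh hδ => ?_⟩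
  rw [lt_div_iff₀ (by positivity)] at hδ
  have h1 := norm_sub_add_norm_le_of_approx (hT.norm_contr_le hh) x w
  have h2 : ‖hT.contr hh w - w‖ ≤ h * ‖y‖ := by
    have h3 : w - hT.contr hh w = h • hT.contr hh y := by
      rw [← hT.yosida_eq_contr hh hy, hT.yosida_apply, smul_inv_smul₀ hh.ne']
    rw [norm_sub_rev, h3, norm_smul, Real.norm_of_nonneg hh.le]
    exact mul_le_mul_of_nonneg_left (hT.norm_contr_le hh y) hh.le
  nlinarith

theorem IsMaximalMonotone.inner_yosida_nonneg {T : H →ₗ.[ℝ] H} (hT : IsMaximalMonotone T)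
    {h : ℝ} (hh : 0 < h) (x : H) : 0 ≤ inner ℝ (hT.yosida hh x) x := by
  rw [hT.yosida_apply, real_inner_smul_left]
  exact mul_nonneg (inv_pos.2 hh).le (inner_sub_self_nonneg_of_norm_le (hT.norm_contr_le hh) x)

end Resolvent

end MonotoneOp

namespace MonotoneOp

/-! ### Powers of `G`: interpolation inequalities, and balls of `D(G ^ k)` closed in `H`. -/

section Powers

variable {H : Type*} [NormedAddCommGroup H] [InnerProductSpace ℝ H] {G : H →ₗ.[ℝ] H}

theorem mem_graph_opPow_zero {x y : H} : (x, y) ∈ (opPow G 0).graph ↔ x = y := by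
  rw [LinearPMap.mem_graph_iff]
  constructor
  · rintro ⟨z, h1, h2⟩
    exact h1.symm.trans h2
  · rintro rfl
    exact ⟨⟨x, trivial⟩, rfl, rfl⟩

/-- Powers are handled through graphs from here on, so that linear combinations and limits do not
carry domain proofs inside terms. -/
theorem mem_graph_opPow_succ {k : ℕ} {x z : H} : (x, z) ∈ (opPow G (k + 1)).graph ↔
    ∃ u, (x, u) ∈ (opPow G k).graph ∧ (u, z) ∈ G.graph := by
  constructor
  · intro h
    obtain ⟨⟨_, y, hy, rfl⟩, rfl, rfl⟩ := (LinearPMap.mem_graph_iff _).1 h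
    exact ⟨opPow G k y, LinearPMap.mem_graph _ y, LinearPMap.mem_graph G ⟨_, hy⟩⟩
  · rintro ⟨u, h1, h2⟩
    obtain ⟨y, rfl, rfl⟩ := (LinearPMap.mem_graph_iff _).1 h1
    obtain ⟨v, hv, rfl⟩ := (LinearPMap.mem_graph_iff _).1 h2
    obtain ⟨v, hv'⟩ := v
    obtain rfl : v = opPow G k y := hv
    exact (LinearPMap.mem_graph_iff _).2 ⟨⟨y, y, hv', rfl⟩, rfl, rfl⟩

theorem mem_graph_opPow_one {x z : H} : (x, z) ∈ (opPow G 1).graph ↔ (x, z) ∈ G.graph := by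
  rw [mem_graph_opPow_succ]
  constructor
  · rintro ⟨u, h1, h2⟩
    rwa [mem_graph_opPow_zero.1 h1]
  · exact fun h => ⟨x, mem_graph_opPow_zero.2 rfl, h⟩

variable [CompleteSpace H]

theorem IsMaximalMonotone.contr_mem_graph_opPow (hG : IsMaximalMonotone G) {h : ℝ} (hh : 0 < h)
    {k : ℕ} {x z : H} (hxz : (x, z) ∈ (opPow G k).graph) :
    (hG.contr hh x, hG.contr hh z) ∈ (opPow G k).graph := by
  induction k generalizing z with
  | zero => rw [mem_graph_opPow_zero] at hxz ⊢; rw [hxz]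
  | succ k ih =>
    obtain ⟨u, h1, h2⟩ := mem_graph_opPow_succ.1 hxz
    exact mem_graph_opPow_succ.2 ⟨_, ih h1, hG.contr_mem_graph_of_mem hh h2⟩

/-- With `J = (1 + h G)⁻¹`, one has `u = J (u + h v) = h⁻¹ (x - J x) + h J v`, and `J` is a
contraction. -/
theorem IsMaximalMonotone.norm_le_landau (hG : IsMaximalMonotone G) {h : ℝ} (hh : 0 < h)
    {x u v : H} (hxu : (x, u) ∈ G.graph) (huv : (u, v) ∈ G.graph) :
    ‖u‖ ≤ 2 / h * ‖x‖ + h * ‖v‖ := by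
  have h1 : hG.yosida hh x = hG.contr hh u := hG.yosida_eq_contr hh hxu
  have h2 := hG.contr_eq hh huv
  rw [map_add, map_smul, ← h1] at h2
  rw [← h2]
  refine (norm_add_le _ _).trans (add_le_add ?_ ?_)
  · rw [hG.yosida_apply, norm_smul, norm_inv, Real.norm_of_nonneg hh.le, div_eq_inv_mul, mul_assoc]
    refine mul_le_mul_of_nonneg_left ?_ (inv_pos.2 hh).le
    linarith [norm_sub_le x (hG.contr hh x), hG.norm_contr_le hh x]
  · rw [norm_smul, Real.norm_of_nonneg hh.le]
    exact mul_le_mul_of_nonneg_left (hG.norm_contr_le hh v) hh.le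

theorem IsMaximalMonotone.exists_interpolation (hG : IsMaximalMonotone G) (k : ℕ) {δ : ℝ}
    (hδ : 0 < δ) : ∃ C > 0, ∀ x u v : H, (x, u) ∈ (opPow G k).graph → (u, v) ∈ G.graph →
      ‖u‖ ≤ C * ‖x‖ + δ * ‖v‖ := by
  induction k generalizing δ with
  | zero =>
    refine ⟨1, one_pos, fun x u v hx _ => ?_⟩
    rw [← mem_graph_opPow_zero.1 hx, one_mul]
    have := mul_nonneg hδ.le (norm_nonneg v)
    linarith
  | succ k ih =>
    -- The Landau inequality is used below with `h = δ / 2`, hence with coefficient `4 / δ`; the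
    -- weight `δ / 8` turns the returning term into `‖u‖ / 2`, which is absorbed on the left.
    obtain ⟨C, hC, h⟩ := ih (δ := δ / 8) (by positivity)
    refine ⟨8 / δ * C, by positivity, fun x u v hxu huv => ?_⟩
    obtain ⟨w, hxw, hwu⟩ := mem_graph_opPow_succ.1 hxu
    have h1 := h x w u hxw hwu
    have h2 := hG.norm_le_landau (half_pos hδ) hwu huv
    have h3 := mul_le_mul_of_nonneg_left h1 (by positivity : 0 ≤ 2 / (δ / 2))
    have h4 : 2 / (δ / 2) * (C * ‖x‖ + δ / 8 * ‖u‖) = (8 / δ * C * ‖x‖) / 2 + ‖u‖ / 2 := by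
      field_simp
      ring
    linarith

theorem IsMaximalMonotone.exists_norm_le_of_le (hG : IsMaximalMonotone G) {j k : ℕ} (hjk : j ≤ k) :
    ∃ C > 0, ∀ x u z : H, (x, u) ∈ (opPow G j).graph → (x, z) ∈ (opPow G k).graph →
      ‖u‖ ≤ C * (‖x‖ + ‖z‖) := by
  induction k, hjk using Nat.le_induction with
  | base =>
    refine ⟨1, one_pos, fun x u z hu hz => ?_⟩
    rw [LinearPMap.mem_graph_snd_inj _ hu hz rfl]
    linarith [norm_nonneg x]
  | succ k hjk ih =>
    obtain ⟨C, hC, h⟩ := ih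
    obtain ⟨C', hC', h'⟩ := hG.exists_interpolation k one_pos
    refine ⟨C * (1 + C'), by positivity, fun x u z hu hz => ?_⟩
    obtain ⟨w, hw, hwz⟩ := mem_graph_opPow_succ.1 hz
    have h1 := h x u w hu hw
    have h2 := h' x w z hw hwz
    have h3 := mul_le_mul_of_nonneg_left h2 hC.le
    have h4 : 0 ≤ C * C' * ‖z‖ := by positivity
    linarith

/-- Interpolation applied to differences: `‖v a - v b‖` is bounded and gets a small weight, `‖x a -
x b‖` tends to zero. -/
theorem IsMaximalMonotone.cauchySeq_of_opPow (hG : IsMaximalMonotone G) {k : ℕ} {x u v : ℕ → H}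
    (hxu : ∀ n, (x n, u n) ∈ (opPow G k).graph) (huv : ∀ n, (u n, v n) ∈ G.graph)
    (hx : CauchySeq x) {C : ℝ} (hv : ∀ n, ‖v n‖ ≤ C) : CauchySeq u := by
  have hC : 0 ≤ C := (norm_nonneg _).trans (hv 0)
  rw [Metric.cauchySeq_iff] at hx ⊢
  intro η hη
  obtain ⟨D, hD, h⟩ := hG.exists_interpolation k (δ := η / (4 * (C + 1))) (by positivity)
  obtain ⟨N, hN⟩ := hx (η / 2 / D) (by positivity)
  refine ⟨N, fun a ha b hb => ?_⟩
  have h1 := h (x a - x b) (u a - u b) (v a - v b) (sub_mem (hxu a) (hxu b))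
    (sub_mem (huv a) (huv b))
  have h2 := hN a ha b hb
  rw [dist_eq_norm, lt_div_iff₀ hD] at h2
  have h3 : ‖v a - v b‖ ≤ 2 * (C + 1) := by
    linarith [norm_sub_le (v a) (v b), hv a, hv b]
  have h4 := mul_le_mul_of_nonneg_left h3 (by positivity : 0 ≤ η / (4 * (C + 1)))
  have h5 : η / (4 * (C + 1)) * (2 * (C + 1)) = η / 2 := by field_simp; norm_num
  rw [dist_eq_norm]
  linarith

theorem IsMaximalMonotone.mem_graph_opPow_of_tendsto (hG : IsMaximalMonotone G) {k : ℕ}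
    {x z : ℕ → H} {x₀ z₀ : H} (hxz : ∀ n, (x n, z n) ∈ (opPow G k).graph)
    (hx : Tendsto x atTop (𝓝 x₀)) (hz : Tendsto z atTop (𝓝 z₀)) :
    (x₀, z₀) ∈ (opPow G k).graph := by
  induction k generalizing z z₀ with
  | zero =>
    have : x = z := funext fun n => mem_graph_opPow_zero.1 (hxz n)
    rw [this] at hx
    exact mem_graph_opPow_zero.2 (tendsto_nhds_unique hx hz)
  | succ k ih =>
    choose u hxu huz using fun n => mem_graph_opPow_succ.1 (hxz n)
    obtain ⟨C, hC⟩ := hz.norm.bddAbove_range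
    obtain ⟨u₀, hu⟩ := cauchySeq_tendsto_of_complete
      (hG.cauchySeq_of_opPow hxu huz hx.cauchySeq fun n => hC ⟨n, rfl⟩)
    exact mem_graph_opPow_succ.2 ⟨u₀, ih hxu hu,
      hG.isClosed_graph.mem_of_tendsto (hu.prodMk_nhds hz) (Eventually.of_forall huz)⟩

/-- Monotonicity of `G` between the points `(1 + μ G)⁻¹ x` and `(1 + ν G)⁻¹ x` yields `⟨G_μ x, G_ν
x⟩ ≥ ‖G_ν x‖ ^ 2`; expanding the square then gives the claim. -/
theorem IsMaximalMonotone.norm_yosida_sub_sq_le (hG : IsMaximalMonotone G) {μ ν : ℝ} (hμ : 0 < μ)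
    (hν : 0 < ν) (hμν : μ ≤ ν) (x : H) :
    ‖hG.yosida hμ x - hG.yosida hν x‖ ^ 2 ≤ ‖hG.yosida hμ x‖ ^ 2 - ‖hG.yosida hν x‖ ^ 2 := by
  have h1 : (hG.contr hμ x - hG.contr hν x, hG.yosida hμ x - hG.yosida hν x) ∈ G.graph :=
    sub_mem (hG.contr_mem_graph hμ x) (hG.contr_mem_graph hν x)
  have h2 := hG.inner_nonneg h1
  have h3 : hG.contr hμ x - hG.contr hν x = ν • hG.yosida hν x - μ • hG.yosida hμ x := by
    rw [hG.yosida_apply, hG.yosida_apply, smul_inv_smul₀ hμ.ne', smul_inv_smul₀ hν.ne']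
    abel
  rw [h3] at h2
  rcases hμν.eq_or_lt with rfl | hlt
  · simp
  · have h0 := norm_sub_sq_real (hG.yosida hμ x) (hG.yosida hν x)
    simp only [inner_sub_left, inner_sub_right, real_inner_smul_right,
      real_inner_self_eq_norm_sq, real_inner_comm (hG.yosida hμ x) (hG.yosida hν x)] at h0 h2
    set a := ‖hG.yosida hμ x‖
    set b := ‖hG.yosida hν x‖
    set p := inner ℝ (hG.yosida hμ x) (hG.yosida hν x)
    have h5 : 0 ≤ (ν - μ) * (p - b ^ 2) := by
      have : 0 ≤ a ^ 2 - 2 * p + b ^ 2 := by rw [← h0]; positivity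
      nlinarith
    have h6 := nonneg_of_mul_nonneg_right h5 (sub_pos.2 hlt)
    linarith

/-- The squared norms of the Yosida approximations increase as the parameter decreases and are
bounded, so by `norm_yosida_sub_sq_le` the approximations are Cauchy. Strong convergence and the
closed graph suffice; no weak compactness is needed. -/
theorem IsMaximalMonotone.exists_mem_graph_of_norm_yosida_le (hG : IsMaximalMonotone G) {x : H}
    {C : ℝ} (h : ∀ (ν : ℝ) (hν : 0 < ν), ‖hG.yosida hν x‖ ≤ C) :
    ∃ z, (x, z) ∈ G.graph ∧ ‖z‖ ≤ C := by
  have hpos : ∀ n : ℕ, 0 < 1 / ((n : ℝ) + 1) := fun n => Nat.one_div_pos_of_nat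
  set y : ℕ → H := fun n => hG.yosida (hpos n) x with hy
  have hmono : ∀ m n : ℕ, m ≤ n → ‖y n - y m‖ ^ 2 ≤ ‖y n‖ ^ 2 - ‖y m‖ ^ 2 := fun m n hmn =>
    hG.norm_yosida_sub_sq_le _ _ (Nat.one_div_le_one_div hmn) x
  have hm : Monotone fun n => ‖y n‖ ^ 2 := fun m n hmn => by
    have := hmono m n hmn
    have h2 : 0 ≤ ‖y n - y m‖ ^ 2 := by positivity
    simp only
    linarith
  have hb : BddAbove (range fun n => ‖y n‖ ^ 2) := ⟨C ^ 2, by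
    rintro _ ⟨n, rfl⟩
    exact pow_le_pow_left₀ (norm_nonneg _) (h _ _) 2⟩
  have hc : CauchySeq y := by
    have h1 := (tendsto_atTop_ciSup hm hb).cauchySeq
    rw [Metric.cauchySeq_iff'] at h1 ⊢
    intro η hη
    obtain ⟨N, hN⟩ := h1 (η ^ 2) (by positivity)
    refine ⟨N, fun n hn => ?_⟩
    have h2 := hmono N n hn
    have h3 := hN n hn
    rw [Real.dist_eq] at h3
    rw [dist_eq_norm]
    exact lt_of_pow_lt_pow_left₀ 2 hη.le (h2.trans_lt ((le_abs_self _).trans_lt h3))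
  obtain ⟨z, hz⟩ := cauchySeq_tendsto_of_complete hc
  have hx : Tendsto (fun n => hG.contr (hpos n) x) atTop (𝓝 x) := by
    have h1 : (fun n => hG.contr (hpos n) x) = fun n : ℕ => x - (1 / ((n : ℝ) + 1)) • y n := by
      funext n
      rw [hy]
      simp only [hG.yosida_apply]
      rw [smul_inv_smul₀ (hpos n).ne', sub_sub_cancel]
    rw [h1]
    have h2 := tendsto_const_nhds (x := x).sub
      ((tendsto_one_div_add_atTop_nhds_zero_nat (𝕜 := ℝ)).smul hz)
    rwa [zero_smul, sub_zero] at h2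
  exact ⟨z, hG.isClosed_graph.mem_of_tendsto (hx.prodMk_nhds hz)
    (Eventually.of_forall fun n => hG.contr_mem_graph _ x),
    le_of_tendsto hz.norm (Eventually.of_forall fun n => h _ _)⟩

/-- The vectors `x` in the domain of `G ^ k` with `‖G ^ k x‖ ≤ C`. -/
def powBall (G : H →ₗ.[ℝ] H) (k : ℕ) (C : ℝ) : Set H :=
  {x | ∃ z, (x, z) ∈ (opPow G k).graph ∧ ‖z‖ ≤ C}

/-- Lower semicontinuity of `‖G ^ k x‖` under convergence in `H`. The top powers `z n` are only
bounded, but the powers one order lower converge by interpolation, and the Yosida approximations at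
their limit inherit the bound. -/
theorem IsMaximalMonotone.mem_powBall_of_tendsto (hG : IsMaximalMonotone G) {k : ℕ} {x : ℕ → H}
    {x₀ : H} {C : ℕ → ℝ} {C₀ : ℝ} (hxC : ∀ n, x n ∈ powBall G k (C n))
    (hx : Tendsto x atTop (𝓝 x₀)) (hC : Tendsto C atTop (𝓝 C₀)) : x₀ ∈ powBall G k C₀ := by
  choose z hxz hz using hxC
  cases k with
  | zero =>
    have : x = z := funext fun n => mem_graph_opPow_zero.1 (hxz n)
    rw [← this] at hz
    exact ⟨x₀, mem_graph_opPow_zero.2 rfl, le_of_tendsto_of_tendsto' hx.norm hC hz⟩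
  | succ k =>
    choose u hxu huz using fun n => mem_graph_opPow_succ.1 (hxz n)
    obtain ⟨B, hB⟩ := hC.bddAbove_range
    obtain ⟨u₀, hu⟩ := cauchySeq_tendsto_of_complete
      (hG.cauchySeq_of_opPow hxu huz hx.cauchySeq fun n => (hz n).trans (hB ⟨n, rfl⟩))
    have hb : ∀ (ν : ℝ) (hν : 0 < ν), ‖hG.yosida hν u₀‖ ≤ C₀ := fun ν hν => by
      refine le_of_tendsto_of_tendsto' (((hG.yosida hν).continuous.tendsto u₀).comp hu).norm hC
        fun n => ?_
      rw [Function.comp_apply, hG.yosida_eq_contr hν (huz n)]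
      exact (hG.norm_contr_le hν _).trans (hz n)
    obtain ⟨z₀, hz₀, hle⟩ := hG.exists_mem_graph_of_norm_yosida_le hb
    exact ⟨z₀, mem_graph_opPow_succ.2
      ⟨u₀, hG.mem_graph_opPow_of_tendsto hxu hx hu, hz₀⟩, hle⟩

theorem IsMaximalMonotone.isClosed_powBall (hG : IsMaximalMonotone G) (k : ℕ) (C : ℝ) :
    IsClosed (powBall G k C) :=
  IsSeqClosed.isClosed fun _ _ hx hlim => hG.mem_powBall_of_tendsto hx hlim tendsto_const_nhds

theorem IsMaximalMonotone.mem_powBall_of_forall_pos (hG : IsMaximalMonotone G) {k : ℕ} {x : H}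
    {C : ℝ} (h : ∀ η > 0, ∃ y ∈ powBall G k (C + η), ‖y - x‖ < η) : x ∈ powBall G k C := by
  choose y hy hyx using fun n : ℕ => h (1 / ((n : ℝ) + 1)) Nat.one_div_pos_of_nat
  refine hG.mem_powBall_of_tendsto hy ?_ ?_
  · exact tendsto_iff_norm_sub_tendsto_zero.2 (squeeze_zero (fun _ => norm_nonneg _)
      (fun n => (hyx n).le) tendsto_one_div_add_atTop_nhds_zero_nat)
  · have := tendsto_const_nhds (x := C).add tendsto_one_div_add_atTop_nhds_zero_nat
    rwa [add_zero] at this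

omit [CompleteSpace H] in
theorem smul_mem_powBall {k : ℕ} {x : H} {C c : ℝ} (hc : 0 ≤ c) (hx : x ∈ powBall G k C) :
    c • x ∈ powBall G k (c * C) := by
  obtain ⟨z, h1, h2⟩ := hx
  refine ⟨c • z, (opPow G k).graph.smul_mem c h1, ?_⟩
  rw [norm_smul, Real.norm_of_nonneg hc]
  exact mul_le_mul_of_nonneg_left h2 hc

omit [CompleteSpace H] in
theorem add_mem_powBall {k : ℕ} {x y : H} {C D : ℝ} (hx : x ∈ powBall G k C)
    (hy : y ∈ powBall G k D) : x + y ∈ powBall G k (C + D) := by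
  obtain ⟨z, h1, h2⟩ := hx
  obtain ⟨w, h3, h4⟩ := hy
  exact ⟨z + w, add_mem h1 h3, (norm_add_le _ _).trans (add_le_add h2 h4)⟩

omit [CompleteSpace H] in
theorem sub_mem_powBall {k : ℕ} {x y : H} {C D : ℝ} (hx : x ∈ powBall G k C)
    (hy : y ∈ powBall G k D) : x - y ∈ powBall G k (C + D) := by
  obtain ⟨z, h1, h2⟩ := hx
  obtain ⟨w, h3, h4⟩ := hy
  exact ⟨z - w, sub_mem h1 h3, (norm_sub_le _ _).trans (add_le_add h2 h4)⟩

omit [CompleteSpace H] in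
theorem powBall_mono {k : ℕ} {C D : ℝ} (h : C ≤ D) : powBall G k C ⊆ powBall G k D := by
  rintro x ⟨z, h1, h2⟩
  exact ⟨z, h1, h2.trans h⟩

theorem IsMaximalMonotone.contr_mem_powBall (hG : IsMaximalMonotone G) {h : ℝ} (hh : 0 < h)
    {k : ℕ} {x : H} {C : ℝ} (hx : x ∈ powBall G k C) : hG.contr hh x ∈ powBall G k C := by
  obtain ⟨z, h1, h2⟩ := hx
  exact ⟨_, hG.contr_mem_graph_opPow hh h1, (hG.norm_contr_le hh z).trans h2⟩

/-- The fixed point equation `y = P (x + c K y)` is solved inside balls of `D(G ^ k)` if `P` and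
`K` preserve them. -/
theorem IsMaximalMonotone.exists_fixedPoint_mem_powBall (hG : IsMaximalMonotone G) {P K : H →L[ℝ] H}
    {k : ℕ} {c p q r C : ℝ} (hc : 0 ≤ c) (hr : 0 ≤ r) (hrc : r * c < 1) (hP : ∀ x, ‖P x‖ ≤ r * ‖x‖)
    (hK : ∀ x, ‖K x‖ ≤ ‖x‖) (hp : 0 ≤ p) (hpq : p * (c * q) < 1)
    (hPG : ∀ x C, x ∈ powBall G k C → P x ∈ powBall G k (p * C))
    (hKG : ∀ x C, x ∈ powBall G k C → K x ∈ powBall G k (q * C)) {x : H}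
    (hx : x ∈ powBall G k C) :
    ∃ y ∈ powBall G k (p * C / (1 - p * (c * q))), P (x + c • K y) = y := by
  set F : H → H := fun y => P (x + c • K y)
  have hF : ContractingWith (r * c).toNNReal F := by
    refine ⟨by rwa [Real.toNNReal_lt_one], LipschitzWith.of_dist_le_mul fun a b => ?_⟩
    rw [Real.coe_toNNReal _ (by positivity), dist_eq_norm, dist_eq_norm]
    have h1 : F a - F b = P (c • K (a - b)) := by
      simp only [F, ← map_sub, add_sub_add_left_eq_sub, ← smul_sub]
    rw [h1, mul_assoc]
    refine (hP _).trans (mul_le_mul_of_nonneg_left ?_ hr)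
    rw [norm_smul, Real.norm_of_nonneg hc]
    exact mul_le_mul_of_nonneg_left (hK _) hc
  set D := p * C / (1 - p * (c * q))
  have hC : 0 ≤ C := by
    obtain ⟨z, -, hz⟩ := hx
    exact (norm_nonneg z).trans hz
  have h0 : (0 : ℝ) < 1 - p * (c * q) := sub_pos.2 hpq
  -- `D` is the radius that one step of the iteration reproduces, so all iterates starting from `0`
  -- stay in the ball of radius `D`.
  have hD : p * (C + c * (q * D)) = D := by
    have h1 : D * (1 - p * (c * q)) = p * C := div_mul_cancel₀ _ h0.ne'
    linear_combination -h1
  have hmaps : ∀ n : ℕ, F^[n] 0 ∈ powBall G k D := by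
    intro n
    induction n with
    | zero => exact ⟨0, zero_mem _, by rw [norm_zero]; positivity⟩
    | succ n ih =>
      rw [Function.iterate_succ_apply', ← hD]
      exact hPG _ _ (add_mem_powBall hx (smul_mem_powBall hc (hKG _ _ ih)))
  exact ⟨_, (hG.isClosed_powBall k D).mem_of_tendsto (hF.tendsto_iterate_fixedPoint 0)
    (Eventually.of_forall hmaps), hF.fixedPoint_isFixedPt⟩

end Powers

end MonotoneOp

namespace MonotoneOp

/-! ### Semigroups generated by bounded monotone operators. -/

section BoundedGenerator

variable {H : Type*} [NormedAddCommGroup H] [InnerProductSpace ℝ H] [CompleteSpace H]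

/-- The semigroup generated by `-B`, for a bounded operator `B`. -/
noncomputable def expSemigroup (B : H →L[ℝ] H) (t : ℝ) : H →L[ℝ] H :=
  NormedSpace.exp (t • (-B))

omit [CompleteSpace H] in
theorem expSemigroup_zero (B : H →L[ℝ] H) : expSemigroup B 0 = 1 := by
  rw [expSemigroup, zero_smul, NormedSpace.exp_zero]

omit [CompleteSpace H] in
theorem expSemigroup_zero_left (t : ℝ) : expSemigroup (0 : H →L[ℝ] H) t = 1 := by
  rw [expSemigroup, neg_zero, smul_zero, NormedSpace.exp_zero]

theorem expSemigroup_add (B : H →L[ℝ] H) (s t : ℝ) :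
    expSemigroup B (s + t) = expSemigroup B s * expSemigroup B t := by
  let _ : NormedAlgebra ℚ (H →L[ℝ] H) := NormedAlgebra.restrictScalars ℚ ℝ _
  rw [expSemigroup, add_smul]
  exact NormedSpace.exp_add_of_commute (((Commute.refl _).smul_left s).smul_right t)

omit [CompleteSpace H] in
theorem commute_expSemigroup {B B' : H →L[ℝ] H} (h : Commute B B') (t : ℝ) :
    Commute B (expSemigroup B' t) := by
  let _ : NormedAlgebra ℚ (H →L[ℝ] H) := NormedAlgebra.restrictScalars ℚ ℝ _
  exact (h.neg_right.smul_right t).exp_right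

theorem hasDerivAt_expSemigroup (B : H →L[ℝ] H) (t : ℝ) :
    HasDerivAt (expSemigroup B) (-(expSemigroup B t * B)) t := by
  have h := hasDerivAt_exp_smul_const (-B) t
  rw [mul_neg] at h
  exact h

theorem hasDerivAt_expSemigroup_apply (B : H →L[ℝ] H) (t : ℝ) (x : H) :
    HasDerivAt (fun s => expSemigroup B s x) (-(expSemigroup B t (B x))) t := by
  have h := (hasDerivAt_expSemigroup B t).clm_apply (hasDerivAt_const t x)
  simpa using h

theorem norm_expSemigroup_apply_le {B : H →L[ℝ] H} (hB : ∀ x, 0 ≤ inner ℝ (B x) x) {t : ℝ}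
    (ht : 0 ≤ t) (x : H) : ‖expSemigroup B t x‖ ≤ ‖x‖ := by
  have hd : ∀ s, HasDerivAt (fun s => ‖expSemigroup B s x‖ ^ 2)
      (2 * inner ℝ (expSemigroup B s x) (-(expSemigroup B s (B x)))) s := fun s =>
    (hasDerivAt_expSemigroup_apply B s x).norm_sq
  have h1 : Antitone fun s => ‖expSemigroup B s x‖ ^ 2 := by
    refine antitone_of_deriv_nonpos (fun s => (hd s).differentiableAt) fun s => ?_
    have h2 : expSemigroup B s (B x) = B (expSemigroup B s x) :=
      (DFunLike.congr_fun (commute_expSemigroup (Commute.refl B) s).eq x).symm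
    rw [(hd s).deriv, inner_neg_right, h2, real_inner_comm]
    linarith [hB (expSemigroup B s x)]
  have h2 := h1 ht
  simp only [expSemigroup_zero, one_apply_eq_self] at h2
  exact le_of_sq_le_sq h2 (norm_nonneg x)

/-- The path `exp (-(t - s) B') exp (-s B) x` joins the two vectors as `s` runs over `[0, t]`; by
commutation its derivative is a product of contractions applied to `B' x - B x`. -/
theorem norm_expSemigroup_sub_le {B B' : H →L[ℝ] H} (hB : ∀ x, 0 ≤ inner ℝ (B x) x)
    (hB' : ∀ x, 0 ≤ inner ℝ (B' x) x) (hc : Commute B' B) {t : ℝ} (ht : 0 ≤ t) (x : H) :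
    ‖expSemigroup B t x - expSemigroup B' t x‖ ≤ t * ‖B x - B' x‖ := by
  have hd : ∀ s, HasDerivAt (fun s => expSemigroup B' (t - s) (expSemigroup B s x))
      (expSemigroup B' (t - s) (expSemigroup B s (B' x - B x))) s := fun s => by
    have h1 : HasDerivAt (fun s => expSemigroup B' (t - s)) (expSemigroup B' (t - s) * B') s := by
      have := (hasDerivAt_expSemigroup B' (t - s)).comp_const_sub t s
      rwa [neg_neg] at this
    convert h1.clm_apply (hasDerivAt_expSemigroup_apply B s x) using 1
    have h2 : expSemigroup B s (B' x) = B' (expSemigroup B s x) :=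
      (DFunLike.congr_fun (commute_expSemigroup hc s).eq x).symm
    rw [map_sub, map_sub, map_neg, h2, mul_apply_eq_comp, sub_eq_add_neg]
  have h := norm_image_sub_le_of_norm_deriv_le_segment' (a := 0) (b := t)
    (fun s _ => (hd s).hasDerivWithinAt) (C := ‖B x - B' x‖) (fun s hs => ?_) t
    (right_mem_Icc.2 ht)
  · simpa [expSemigroup_zero, mul_comm] using h
  · rw [norm_sub_rev (B x)]
    exact (norm_expSemigroup_apply_le hB' (sub_nonneg.2 hs.2.le) _).trans
      (norm_expSemigroup_apply_le hB hs.1 _)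

theorem norm_expSemigroup_sub_self_le {B : H →L[ℝ] H} (hB : ∀ x, 0 ≤ inner ℝ (B x) x) {t : ℝ}
    (ht : 0 ≤ t) (x : H) : ‖expSemigroup B t x - x‖ ≤ t * ‖B x‖ := by
  have h := norm_expSemigroup_sub_le hB (B' := 0) (by simp) (Commute.zero_left B) ht x
  simpa [expSemigroup_zero_left] using h

theorem norm_expSemigroup_sub_add_le {B : H →L[ℝ] H} {t M : ℝ} (ht : 0 ≤ t) (x : H)
    (hM : ∀ s, 0 ≤ s → s ≤ t → ‖expSemigroup B s (B x) - B x‖ ≤ M) :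
    ‖expSemigroup B t x - x + t • B x‖ ≤ t * M := by
  have hd : ∀ s, HasDerivAt (fun s => expSemigroup B s x + s • B x)
      (-(expSemigroup B s (B x)) + (1 : ℝ) • B x) s := fun s =>
    (hasDerivAt_expSemigroup_apply B s x).add ((hasDerivAt_id s).smul_const (B x))
  have h := norm_image_sub_le_of_norm_deriv_le_segment' (a := 0) (b := t)
    (fun s _ => (hd s).hasDerivWithinAt) (C := M) (fun s hs => ?_) t (right_mem_Icc.2 ht)
  · simpa [expSemigroup_zero, mul_comm, add_sub_right_comm] using h
  · rw [one_smul, neg_add_eq_sub, norm_sub_rev]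
    exact hM s hs.1 hs.2.le

end BoundedGenerator

/-! ### The Hille–Yosida theorem, by Yosida approximation. -/

section HilleYosida

variable {H : Type*} [NormedAddCommGroup H] [InnerProductSpace ℝ H] [CompleteSpace H]
  {T : H →ₗ.[ℝ] H}

/-- The Yosida approximations along `h = 1 / (n + 1)`. -/
noncomputable def IsMaximalMonotone.yosidaSeq (hT : IsMaximalMonotone T) (n : ℕ) : H →L[ℝ] H :=
  hT.yosida (Nat.one_div_pos_of_nat (α := ℝ) (n := n))

theorem IsMaximalMonotone.inner_yosidaSeq_nonneg (hT : IsMaximalMonotone T) (n : ℕ) (x : H) :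
    0 ≤ inner ℝ (hT.yosidaSeq n x) x := hT.inner_yosida_nonneg _ x

theorem IsMaximalMonotone.norm_yosidaSeq_le (hT : IsMaximalMonotone T) (n : ℕ) {x y : H}
    (h : (x, y) ∈ T.graph) : ‖hT.yosidaSeq n x‖ ≤ ‖y‖ := by
  rw [yosidaSeq, hT.yosida_eq_contr _ h]
  exact hT.norm_contr_le _ y

theorem IsMaximalMonotone.commute_yosidaSeq (hT : IsMaximalMonotone T) (m n : ℕ) :
    Commute (hT.yosidaSeq m) (hT.yosidaSeq n) := by
  have h : Commute (hT.contr (Nat.one_div_pos_of_nat (α := ℝ) (n := m)))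
      (hT.contr (Nat.one_div_pos_of_nat (α := ℝ) (n := n))) :=
    ContinuousLinearMap.ext fun x => hT.contr_comm _ _ x
  have h2 := ((Commute.one_left (1 : H →L[ℝ] H)).sub_left (Commute.one_right _)).sub_right
    ((Commute.one_left _).sub_left h)
  exact (h2.smul_left (1 / ((m : ℝ) + 1))⁻¹).smul_right (1 / ((n : ℝ) + 1))⁻¹

theorem IsMaximalMonotone.tendsto_yosidaSeq (hT : IsMaximalMonotone T) {x y : H}
    (h : (x, y) ∈ T.graph) : Tendsto (fun n => hT.yosidaSeq n x) atTop (𝓝 y) := by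
  rw [Metric.tendsto_atTop]
  intro η hη
  obtain ⟨δ, hδ, hlt⟩ := hT.exists_norm_contr_sub_lt y hη
  obtain ⟨N, hN⟩ := exists_nat_one_div_lt hδ
  refine ⟨N, fun n hn => ?_⟩
  rw [yosidaSeq, hT.yosida_eq_contr _ h, dist_eq_norm]
  exact hlt _ _ ((Nat.one_div_le_one_div hn).trans_lt hN)

theorem IsMaximalMonotone.cauchySeq_expSemigroup (hT : IsMaximalMonotone T) {t : ℝ} (ht : 0 ≤ t)
    (x : H) : CauchySeq fun n => expSemigroup (hT.yosidaSeq n) t x := by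
  rw [Metric.cauchySeq_iff]
  intro η hη
  obtain ⟨w, hw, hxw⟩ := Metric.mem_closure_iff.1 (hT.dense_domain x) (η / 4) (by linarith)
  obtain ⟨y, hy⟩ := LinearPMap.mem_domain_iff.1 hw
  rw [dist_eq_norm] at hxw
  obtain ⟨N, hN⟩ := Metric.cauchySeq_iff.1 (hT.tendsto_yosidaSeq hy).cauchySeq
    (η / 2 / (t + 1)) (by positivity)
  refine ⟨N, fun m hm n hn => ?_⟩
  have h1 := hN m hm n hn
  rw [dist_eq_norm, lt_div_iff₀ (by positivity)] at h1
  have h2 := norm_expSemigroup_sub_le (hT.inner_yosidaSeq_nonneg m) (hT.inner_yosidaSeq_nonneg n)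
    (hT.commute_yosidaSeq n m) ht w
  have h3 := norm_expSemigroup_apply_le (hT.inner_yosidaSeq_nonneg m) ht (x - w)
  have h4 := norm_expSemigroup_apply_le (hT.inner_yosidaSeq_nonneg n) ht (x - w)
  have h5 : expSemigroup (hT.yosidaSeq m) t x - expSemigroup (hT.yosidaSeq n) t x
      = expSemigroup (hT.yosidaSeq m) t (x - w) - expSemigroup (hT.yosidaSeq n) t (x - w)
        + (expSemigroup (hT.yosidaSeq m) t w - expSemigroup (hT.yosidaSeq n) t w) := by
    rw [map_sub, map_sub]; abel
  rw [dist_eq_norm, h5]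
  have h6 := norm_add_le
    (expSemigroup (hT.yosidaSeq m) t (x - w) - expSemigroup (hT.yosidaSeq n) t (x - w))
    (expSemigroup (hT.yosidaSeq m) t w - expSemigroup (hT.yosidaSeq n) t w)
  have h7 := norm_sub_le (expSemigroup (hT.yosidaSeq m) t (x - w))
    (expSemigroup (hT.yosidaSeq n) t (x - w))
  nlinarith [norm_nonneg (hT.yosidaSeq m w - hT.yosidaSeq n w)]

theorem IsMaximalMonotone.exists_tendsto_expSemigroup (hT : IsMaximalMonotone T) :
    ∃ S : ℝ → H →L[ℝ] H, ∀ t, 0 ≤ t → ∀ x,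
      Tendsto (fun n => expSemigroup (hT.yosidaSeq n) t x) atTop (𝓝 (S t x)) := by
  have h : ∀ t : ℝ, ∃ L : H →L[ℝ] H, 0 ≤ t → ∀ x,
      Tendsto (fun n => expSemigroup (hT.yosidaSeq n) t x) atTop (𝓝 (L x)) := by
    intro t
    by_cases ht : 0 ≤ t
    · choose f hf using fun x => cauchySeq_tendsto_of_complete (hT.cauchySeq_expSemigroup ht x)
      exact ⟨continuousLinearMapOfTendsto (fun n => expSemigroup (hT.yosidaSeq n) t)
        (tendsto_pi_nhds.2 hf), fun _ => hf⟩
    · exact ⟨0, fun h => absurd h ht⟩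
  choose S hS using h
  exact ⟨S, hS⟩

omit [CompleteSpace H] in
/-- A family of contractions that composes like a semigroup and moves a dense set of vectors at
bounded speed is a contraction semigroup. -/
theorem isContractionSemigroup_of_norm_sub_le {S : ℝ → H →L[ℝ] H} {D : Set H} (hD : Dense D)
    (h0 : S 0 = ContinuousLinearMap.id ℝ H)
    (hadd : ∀ s t : ℝ, 0 ≤ s → 0 ≤ t → S (s + t) = (S s).comp (S t))
    (hle : ∀ t : ℝ, 0 ≤ t → ∀ x, ‖S t x‖ ≤ ‖x‖)
    (hlip : ∀ w ∈ D, ∃ C, ∀ t : ℝ, 0 ≤ t → ‖S t w - w‖ ≤ t * C) : IsContractionSemigroup S := by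
  refine ⟨h0, hadd, fun t ht => ContinuousLinearMap.opNorm_le_bound _ zero_le_one fun x => by
    rw [one_mul]; exact hle t ht x, fun x => ?_⟩
  have key : ∀ η > 0, ∃ δ > 0, ∀ t : ℝ, 0 ≤ t → t < δ → ‖S t x - x‖ < η := by
    intro η hη
    obtain ⟨w, hw, hxw⟩ := Metric.mem_closure_iff.1 (hD x) (η / 4) (by linarith)
    obtain ⟨C, hC⟩ := hlip w hw
    rw [dist_eq_norm] at hxw
    refine ⟨η / 2 / (|C| + 1), by positivity, fun t ht hδ => ?_⟩
    rw [lt_div_iff₀ (by positivity)] at hδ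
    have h1 := norm_sub_add_norm_le_of_approx (hle t ht) x w
    have h2 := hC t ht
    nlinarith [le_abs_self C]
  rw [Metric.continuousOn_iff]
  intro s hs η hη
  obtain ⟨δ, hδ, h⟩ := key η hη
  have hst : ∀ a b : ℝ, 0 ≤ a → a ≤ b → b - a < δ → dist (S b x) (S a x) < η := by
    intro a b ha hab hlt
    have h1 : S b x - S a x = S a (S (b - a) x - x) := by
      rw [map_sub]
      conv_lhs => rw [← add_sub_cancel a b, hadd a (b - a) ha (sub_nonneg.2 hab)]
      rfl
    rw [dist_eq_norm, h1]
    exact (hle a ha _).trans_lt (h _ (sub_nonneg.2 hab) hlt)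
  refine ⟨δ, hδ, fun t ht htδ => ?_⟩
  rw [Real.dist_eq, abs_lt] at htδ
  rcases le_total s t with hle' | hle'
  · exact hst s t hs hle' htδ.2
  · rw [dist_comm]
    exact hst t s ht hle' (by linarith)

/-- The Hille–Yosida theorem for maximal monotone operators. -/
theorem IsMaximalMonotone.exists_semigroup (hT : IsMaximalMonotone T) :
    ∃ S : ℝ → H →L[ℝ] H, IsContractionSemigroup S ∧ HasGeneratorNeg S T := by
  obtain ⟨S, hS⟩ := hT.exists_tendsto_expSemigroup
  have hle : ∀ t : ℝ, 0 ≤ t → ∀ x, ‖S t x‖ ≤ ‖x‖ := fun t ht x =>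
    le_of_tendsto (hS t ht x).norm (Eventually.of_forall fun n =>
      norm_expSemigroup_apply_le (hT.inner_yosidaSeq_nonneg n) ht x)
  have hsg : IsContractionSemigroup S := by
    refine isContractionSemigroup_of_norm_sub_le hT.dense_domain ?_ ?_ hle ?_
    · ext x
      refine tendsto_nhds_unique (hS 0 le_rfl x) ?_
      simp only [expSemigroup_zero]
      exact tendsto_const_nhds
    · intro s t hs ht
      ext x
      refine tendsto_nhds_unique (hS (s + t) (add_nonneg hs ht) x) ?_
      have h1 : Tendsto (fun n => expSemigroup (hT.yosidaSeq n) s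
          (expSemigroup (hT.yosidaSeq n) t x - S t x)) atTop (𝓝 0) := by
        refine squeeze_zero_norm (fun n =>
          norm_expSemigroup_apply_le (hT.inner_yosidaSeq_nonneg n) hs _) ?_
        exact tendsto_iff_norm_sub_tendsto_zero.1 (hS t ht x)
      have h2 := h1.add (hS s hs (S t x))
      rw [zero_add] at h2
      refine h2.congr fun n => ?_
      rw [map_sub, sub_add_cancel, expSemigroup_add]
      rfl
    · intro w hw
      obtain ⟨y, hy⟩ := LinearPMap.mem_domain_iff.1 hw
      refine ⟨‖y‖, fun t ht => le_of_tendsto ((hS t ht w).sub_const w).norm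
        (Eventually.of_forall fun n => ?_)⟩
      exact (norm_expSemigroup_sub_self_le (hT.inner_yosidaSeq_nonneg n) ht w).trans
        (mul_le_mul_of_nonneg_left (hT.norm_yosidaSeq_le n hy) ht)
  -- First order expansion of the semigroup, inherited from the approximations. Since `y = T x` need
  -- not lie in the domain, it is compared with a domain vector `w`.
  have htaylor : ∀ x y, (x, y) ∈ T.graph → ∀ w w', (w, w') ∈ T.graph → ∀ t : ℝ, 0 ≤ t →
      ‖S t x - x + t • y‖ ≤ t * (2 * ‖y - w‖ + t * ‖w'‖) := by
    intro x y hxy w w' hw t ht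
    have hy := hT.tendsto_yosidaSeq hxy
    refine le_of_tendsto_of_tendsto' (((hS t ht x).sub_const x).add (hy.const_smul t)).norm
      ((((hy.sub_const w).norm.const_mul 2).add_const (t * ‖w'‖)).const_mul t) fun n => ?_
    refine norm_expSemigroup_sub_add_le ht x fun s hs hst => ?_
    refine (norm_sub_add_norm_le_of_approx
      (norm_expSemigroup_apply_le (hT.inner_yosidaSeq_nonneg n) hs) _ w).trans ?_
    gcongr
    refine (norm_expSemigroup_sub_self_le (hT.inner_yosidaSeq_nonneg n) hs w).trans ?_
    exact mul_le_mul hst (hT.norm_yosidaSeq_le n hw) (norm_nonneg _) ht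
  have hgen : ∀ x y, (x, y) ∈ T.graph →
      Tendsto (fun t : ℝ => t⁻¹ • (x - S t x)) (𝓝[>] 0) (𝓝 y) := by
    intro x y hxy
    rw [Metric.tendsto_nhdsWithin_nhds]
    intro η hη
    obtain ⟨w, hw, hyw⟩ := Metric.mem_closure_iff.1 (hT.dense_domain y) (η / 4) (by linarith)
    obtain ⟨w', hw'⟩ := LinearPMap.mem_domain_iff.1 hw
    rw [dist_eq_norm] at hyw
    refine ⟨η / 2 / (‖w'‖ + 1), by positivity, fun t ht htδ => ?_⟩
    rw [mem_Ioi] at ht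
    rw [Real.dist_eq, sub_zero, abs_of_pos ht, lt_div_iff₀ (by positivity)] at htδ
    have h1 := htaylor x y hxy w w' hw' t ht.le
    have h2 : t⁻¹ • (x - S t x) - y = -(t⁻¹ • (S t x - x + t • y)) := by
      rw [smul_add, inv_smul_smul₀ ht.ne', neg_add, ← smul_neg, neg_sub, sub_eq_add_neg]
    rw [dist_eq_norm, h2, norm_neg, norm_smul, norm_inv, Real.norm_of_nonneg ht.le,
      inv_mul_lt_iff₀ ht]
    refine h1.trans_lt (mul_lt_mul_of_pos_left ?_ ht)
    linarith
  refine ⟨S, hsg, fun x y => ⟨hgen x y, fun h => ?_⟩⟩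
  -- Converse inclusion by maximality: the generator is monotone, and `z + T z = x + y` turns `0 ≤
  -- ⟨y - T z, x - z⟩` into `0 ≤ -‖x - z‖ ^ 2`.
  obtain ⟨z, hz⟩ := hT.range_eq_top (x + y)
  have h1 := h.sub (hgen _ _ (T.mem_graph z))
  have h2 : y - T z = -(x - z) := by
    rw [eq_sub_of_add_eq' hz]
    abel
  have h3 : 0 ≤ inner ℝ (y - T z) (x - z) := by
    refine ge_of_tendsto (h1.inner tendsto_const_nhds) ?_
    filter_upwards [self_mem_nhdsWithin] with t ht
    have ht' : 0 < t := ht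
    have h4 : t⁻¹ • (x - S t x) - t⁻¹ • ((z : H) - S t z) = t⁻¹ • (x - z - S t (x - z)) := by
      rw [← smul_sub, map_sub]
      congr 1
      abel
    rw [h4, real_inner_smul_left]
    exact mul_nonneg (inv_pos.2 ht').le (inner_sub_self_nonneg_of_norm_le (hle t ht'.le) _)
  rw [h2, inner_neg_left, real_inner_self_eq_norm_sq] at h3
  have h5 : ‖x - (z : H)‖ = 0 := by nlinarith [norm_nonneg (x - (z : H))]
  have h6 : x = z := sub_eq_zero.1 (norm_eq_zero.1 h5)
  have h7 : y = T z := by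
    rw [h6, sub_self, neg_zero] at h2
    exact sub_eq_zero.1 h2
  rw [h6, h7]
  exact T.mem_graph z

/-- The default value in `semigroup` is not taken, so the bound in `StandingAssumption` concerns the
actual semigroup. -/
theorem IsMaximalMonotone.semigroup_spec (hT : IsMaximalMonotone T) :
    IsContractionSemigroup (semigroup T) ∧ HasGeneratorNeg (semigroup T) T := by
  have h := hT.exists_semigroup
  rw [semigroup, dif_pos h]
  exact h.choose_spec

end HilleYosida

end MonotoneOp

namespace MonotoneOp

/-! ### Bounds for the resolvents on `D(G ^ k)`, uniform in `ε`. -/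

section ResolventBounds

variable {H : Type*} [NormedAddCommGroup H] [InnerProductSpace ℝ H] {A G : H →ₗ.[ℝ] H}

/-- Energy estimate: pair the equation with `d`; the terms in `a` and in `d - K d` contribute
nonnegatively. It measures the error of both approximation schemes below. -/
theorem mul_norm_le_of_eq {K : H →L[ℝ] H} (hK : ∀ x, ‖K x‖ ≤ ‖x‖) {l c : ℝ} (hc : 0 ≤ c)
    {a d e : H} (ha : 0 ≤ inner ℝ a d) (h : l • d + a + c • (d - K d) = e) :
    l * ‖d‖ ≤ ‖e‖ := by
  have h1 := real_inner_le_norm e d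
  rw [← h, inner_add_left, inner_add_left, real_inner_smul_left, real_inner_smul_left,
    real_inner_self_eq_norm_sq, h] at h1
  have h2 := mul_nonneg hc (inner_sub_self_nonneg_of_norm_le hK d)
  rcases (norm_nonneg d).eq_or_lt with h0 | h0
  · rw [← h0, mul_zero]
    exact norm_nonneg e
  · nlinarith

theorem mem_graph_add_smul {ε : ℝ} {x y : H} : (x, y) ∈ (A + ε • G).graph ↔
    ∃ a g, (x, a) ∈ A.graph ∧ (x, g) ∈ G.graph ∧ a + ε • g = y := by
  constructor
  · intro h
    obtain ⟨z, rfl, rfl⟩ := (LinearPMap.mem_graph_iff _).1 h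
    exact ⟨A ⟨z, z.2.1⟩, G ⟨z, z.2.2⟩, A.mem_graph ⟨z, z.2.1⟩, G.mem_graph ⟨z, z.2.2⟩, rfl⟩
  · rintro ⟨a, g, ha, hg, rfl⟩
    obtain ⟨⟨x, hx⟩, rfl, rfl⟩ := (LinearPMap.mem_graph_iff _).1 ha
    obtain ⟨⟨x', hx'⟩, h, rfl⟩ := (LinearPMap.mem_graph_iff _).1 hg
    obtain rfl : x' = x := h
    exact (LinearPMap.mem_graph_iff _).2 ⟨⟨x', hx, hx'⟩, rfl, rfl⟩

theorem mem_graph_closedSum {ε : ℝ} {x a g : H} (ha : (x, a) ∈ A.graph) (hg : (x, g) ∈ G.graph) :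
    (x, a + ε • g) ∈ (closedSum A G ε).graph :=
  LinearPMap.le_graph_of_le (LinearPMap.le_closure _) (mem_graph_add_smul.2 ⟨a, g, ha, hg, rfl⟩)

theorem exists_mem_graph_of_mem_closedSum {ε : ℝ} {x y : H}
    (h : (x, y) ∈ (closedSum A G ε).graph) {η : ℝ} (hη : 0 < η) :
    ∃ w a g, (w, a) ∈ A.graph ∧ (w, g) ∈ G.graph ∧ ‖x - w‖ < η ∧ ‖y - (a + ε • g)‖ < η := by
  have h1 : (x, y) ∈ closure ((A + ε • G).graph : Set (H × H)) := by
    by_cases hc : (A + ε • G).IsClosable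
    · rw [closedSum, ← hc.graph_closure_eq_closure_graph] at h
      exact h
    -- For a non-closable operator, `closure` returns the operator itself, so closability need not
    -- be established.
    · rw [closedSum, LinearPMap.closure_def' hc] at h
      exact subset_closure h
  obtain ⟨⟨w, v⟩, hwv, hlt⟩ := Metric.mem_closure_iff.1 h1 η hη
  obtain ⟨a, g, ha, hg, rfl⟩ := mem_graph_add_smul.1 hwv
  rw [Prod.dist_eq, max_lt_iff, dist_eq_norm, dist_eq_norm] at hlt
  exact ⟨w, a, g, ha, hg, hlt.1, hlt.2⟩

variable [CompleteSpace H]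

/-- For small `t`, solve `l y + t⁻¹ (y - S t y) = x`, that is `y = (l + t⁻¹)⁻¹ (x + t⁻¹ S t y)`. The
solution has `‖G ^ k y‖ ≤ C / (l - t⁻¹ (exp (α t) - 1))`, and as `t → 0` it tends to the resolvent
because `-A` generates `S`. This replaces the Laplace transform of the semigroup. -/
theorem IsMaximalMonotone.resolvent_mem_powBall (hG : IsMaximalMonotone G)
    (hA : IsMaximalMonotone A) {S : ℝ → H →L[ℝ] H} (hS : IsContractionSemigroup S)
    (hSA : HasGeneratorNeg S A) {k : ℕ} {α : ℝ}
    (hSG : ∀ t, 0 ≤ t → ∀ x C, x ∈ powBall G k C → S t x ∈ powBall G k (Real.exp (α * t) * C))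
    {l : ℝ} (hl : 0 < l) (hαl : α < l) {x : H} {C : ℝ} (hx : x ∈ powBall G k C) :
    resolvent A l x ∈ powBall G k ((l - α)⁻¹ * C) := by
  refine hG.mem_powBall_of_forall_pos fun η hη => ?_
  set w := resolvent A l x
  have hlim : Tendsto (fun t : ℝ => t⁻¹ * (Real.exp (α * t) - 1)) (𝓝[>] 0) (𝓝 α) := by
    have h1 : HasDerivAt (fun t : ℝ => Real.exp (α * t)) α 0 := by
      have := ((hasDerivAt_id (0 : ℝ)).const_mul α).exp
      simpa using this
    have h2 := h1.tendsto_slope_zero_right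
    simpa using h2
  have hlim' : Tendsto (fun t : ℝ => (l - t⁻¹ * (Real.exp (α * t) - 1))⁻¹ * C) (𝓝[>] 0)
      (𝓝 ((l - α)⁻¹ * C)) :=
    ((hlim.const_sub l).inv₀ (sub_pos.2 hαl).ne').mul_const C
  have hgen := (hSA _ _).1 (hA.resolvent_mem_graph hl x)
  rw [tendsto_iff_norm_sub_tendsto_zero] at hgen
  obtain ⟨t, ⟨⟨h1, h2⟩, h3⟩, ht⟩ := (((hlim.eventually_lt_const hαl).and
    (hlim'.eventually_lt_const (lt_add_of_pos_right _ hη))).and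
    (hgen.eventually_lt_const (mul_pos hl hη))).and self_mem_nhdsWithin |>.exists
  have ht : 0 < t := ht
  have hc : 0 < t⁻¹ := inv_pos.2 ht
  have hlc : 0 < l + t⁻¹ := add_pos hl hc
  have hSle : ∀ z, ‖S t z‖ ≤ ‖z‖ := fun z => by
    simpa using (S t).le_of_opNorm_le (hS.contraction t ht.le) z
  have hden : 1 - (l + t⁻¹)⁻¹ * (t⁻¹ * Real.exp (α * t))
      = (l + t⁻¹)⁻¹ * (l - t⁻¹ * (Real.exp (α * t) - 1)) := by
    have h4 : (l + t⁻¹)⁻¹ * (l + t⁻¹) = 1 := inv_mul_cancel₀ hlc.ne'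
    linear_combination -h4
  have hpos : 0 < 1 - (l + t⁻¹)⁻¹ * (t⁻¹ * Real.exp (α * t)) := by
    rw [hden]
    exact mul_pos (inv_pos.2 hlc) (sub_pos.2 h1)
  obtain ⟨y, hy, hfix⟩ := hG.exists_fixedPoint_mem_powBall
    (P := (l + t⁻¹)⁻¹ • ContinuousLinearMap.id ℝ H) (K := S t) hc.le (inv_pos.2 hlc).le
    (by rw [inv_mul_lt_iff₀ hlc]; linarith)
    (fun z => by
      change ‖(l + t⁻¹)⁻¹ • z‖ ≤ _
      rw [norm_smul, Real.norm_of_nonneg (inv_pos.2 hlc).le])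
    hSle (inv_pos.2 hlc).le (sub_pos.1 hpos)
    (fun z D hz => smul_mem_powBall (inv_pos.2 hlc).le hz) (hSG t ht.le) hx
  have hDeq : (l + t⁻¹)⁻¹ * C / (1 - (l + t⁻¹)⁻¹ * (t⁻¹ * Real.exp (α * t)))
      = (l - t⁻¹ * (Real.exp (α * t) - 1))⁻¹ * C := by
    rw [hden, mul_div_mul_left _ _ (inv_pos.2 hlc).ne', div_eq_inv_mul]
  rw [hDeq] at hy
  refine ⟨y, powBall_mono h2.le hy, ?_⟩
  have hfix' : x + t⁻¹ • S t y = (l + t⁻¹) • y := by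
    have h4 : (l + t⁻¹)⁻¹ • (x + t⁻¹ • S t y) = y := hfix
    rw [← h4, smul_inv_smul₀ hlc.ne', h4]
  have h4 : l • (y - w) + 0 + t⁻¹ • ((y - w) - S t (y - w))
      = -(t⁻¹ • (w - S t w) - (x - l • w)) := by
    rw [eq_sub_of_add_eq hfix', map_sub]
    module
  have h5 := mul_norm_le_of_eq hSle hc.le (by rw [inner_zero_left]) h4
  rw [norm_neg] at h5
  exact lt_of_mul_lt_mul_left (h5.trans_lt h3) hl.le

/-- Replace `G` by its Yosida approximation with parameter `μ` and put `c = ε / μ`: the equation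
becomes `y = (l + c + A)⁻¹ (x + c (1 + μ G)⁻¹ y)`. The shift of `l` by `c` exactly compensates the
factor `c`, so the radius is `C / (l - α)` for every `μ`. -/
theorem IsMaximalMonotone.resolvent_closedSum_mem_powBall (hG : IsMaximalMonotone G)
    (hA : IsMaximalMonotone A) {ε : ℝ} (hε : 0 < ε) (hT : IsMaximalMonotone (closedSum A G ε))
    {k : ℕ} {α : ℝ} (hAG : ∀ l, 0 < l → α < l → ∀ x C, x ∈ powBall G k C →
      resolvent A l x ∈ powBall G k ((l - α)⁻¹ * C))
    {l : ℝ} (hl : 0 < l) (hαl : α < l) {x : H} {C : ℝ} (hx : x ∈ powBall G k C) :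
    resolvent (closedSum A G ε) l x ∈ powBall G k ((l - α)⁻¹ * C) := by
  refine hG.mem_powBall_of_forall_pos fun η hη => ?_
  set w := resolvent (closedSum A G ε) l x
  -- The final error is at most `(l + 1 + ε) / l` times `η / θ` for `y - w'`, plus `η / θ` for `w' -
  -- w`.
  set θ := (l + 1 + ε) / l + 1
  have hθ : 0 < θ := by positivity
  obtain ⟨w', a, g, ha, hg, h1, h2⟩ := exists_mem_graph_of_mem_closedSum
    (hT.resolvent_mem_graph hl x) (div_pos hη hθ)
  obtain ⟨δ, hδ, hlt⟩ := hG.exists_norm_contr_sub_lt g (div_pos hη hθ)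
  have hμ : 0 < δ / 2 := half_pos hδ
  have h3 := hlt _ hμ (half_lt_self hδ)
  set η' := η / θ
  set c := ε / (δ / 2)
  have hc : 0 < c := div_pos hε hμ
  have hlc : 0 < l + c := add_pos hl hc
  have hlcα : 0 < l + c - α := by linarith
  have hden : 1 - (l + c - α)⁻¹ * (c * 1) = (l + c - α)⁻¹ * (l - α) := by
    have h4 : (l + c - α)⁻¹ * (l + c - α) = 1 := inv_mul_cancel₀ hlcα.ne'
    linear_combination -h4
  have hpos : 0 < 1 - (l + c - α)⁻¹ * (c * 1) := by
    rw [hden]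
    exact mul_pos (inv_pos.2 hlcα) (sub_pos.2 hαl)
  obtain ⟨y, hy, hfix⟩ := hG.exists_fixedPoint_mem_powBall (P := hA.resolventCLM hlc)
    (K := hG.contr hμ) hc.le (inv_pos.2 hlc).le (by rw [inv_mul_lt_iff₀ hlc]; linarith)
    (hA.norm_resolvent_le hlc) (hG.norm_contr_le hμ) (inv_pos.2 hlcα).le (sub_pos.1 hpos)
    (hAG (l + c) hlc (by linarith))
    (fun z D hz => by rw [one_mul]; exact hG.contr_mem_powBall hμ hz) hx
  rw [hden, mul_div_mul_left _ _ (inv_pos.2 hlcα).ne', div_eq_inv_mul] at hy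
  refine ⟨y, powBall_mono (le_add_of_nonneg_right hη.le) hy, ?_⟩
  have hyA := hA.resolvent_mem_graph hlc (x + c • hG.contr hμ y)
  rw [← hA.resolventCLM_apply hlc, hfix] at hyA
  have hg' : c • (w' - hG.contr hμ w') = ε • hG.contr hμ g := by
    rw [← hG.yosida_eq_contr hμ hg, hG.yosida_apply, smul_smul, ← div_eq_mul_inv]
  have hmem : (y - w', x + c • hG.contr hμ y - (l + c) • y - a) ∈ A.graph := sub_mem hyA ha
  have h4 : l • (y - w') + (x + c • hG.contr hμ y - (l + c) • y - a)
      + c • ((y - w') - hG.contr hμ (y - w'))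
      = l • (w - w') + (x - l • w - (a + ε • g)) - ε • (hG.contr hμ g - g) := by
    rw [smul_sub ε, ← hg', map_sub]
    module
  have h5 := mul_norm_le_of_eq (hG.norm_contr_le hμ) hc.le (hA.inner_nonneg hmem) h4
  have h6 := norm_sub_le (l • (w - w') + (x - l • w - (a + ε • g))) (ε • (hG.contr hμ g - g))
  have h7 := norm_add_le (l • (w - w')) (x - l • w - (a + ε • g))
  rw [norm_smul, Real.norm_of_nonneg hl.le] at h7
  rw [norm_smul, Real.norm_of_nonneg hε.le] at h6
  have h8 : l * ‖y - w'‖ < (l + 1 + ε) * η' := by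
    nlinarith
  have h9 : ‖y - w'‖ < (l + 1 + ε) / l * η' := by
    rw [div_mul_eq_mul_div, lt_div_iff₀ hl]
    linarith
  have h10 : (l + 1 + ε) / l * η' + η' = η := by
    have : θ * η' = η := mul_div_cancel₀ _ hθ.ne'
    rw [← this]
    ring
  have h11 := norm_sub_le_norm_sub_add_norm_sub y w' w
  rw [norm_sub_rev w' w] at h11
  linarith

theorem IsMaximalMonotone.perturbedResolvent_mem_powBall {m : ℕ} {α : ℕ → ℝ}
    (hA : IsMaximalMonotone A) (hG : IsMaximalMonotone G) (hAG : StandingAssumption A G m α)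
    {k : ℕ} (hk : k ∈ Icc 1 (m + 1)) {l : ℝ} (hl : 0 < l) (hαl : α k < l) {ε : ℝ}
    (hε : ε ∈ Icc (0 : ℝ) 1) {x : H} {C : ℝ} (hx : x ∈ powBall G k C) :
    perturbedResolvent A G l ε x ∈ powBall G k ((l - α k)⁻¹ * C) := by
  have h0 : ∀ l, 0 < l → α k < l → ∀ x C, x ∈ powBall G k C →
      resolvent A l x ∈ powBall G k ((l - α k)⁻¹ * C) := by
    intro l hl hαl x C hx
    refine hG.resolvent_mem_powBall hA hA.semigroup_spec.1 hA.semigroup_spec.2 ?_ hl hαl hx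
    rintro t ht x C ⟨z, hz, hzC⟩
    obtain ⟨x, rfl, rfl⟩ := (LinearPMap.mem_graph_iff _).1 hz
    obtain ⟨hm, hle⟩ := hAG.bound k hk x t ht
    exact ⟨_, LinearPMap.mem_graph _ ⟨_, hm⟩,
      hle.trans (mul_le_mul_of_nonneg_left hzC (Real.exp_pos _).le)⟩
  rw [perturbedResolvent]
  split_ifs with hε0
  · exact h0 l hl hαl x C hx
  · have hpos : 0 < ε := lt_of_le_of_ne hε.1 (Ne.symm hε0)
    exact hG.resolvent_closedSum_mem_powBall hA hpos (hAG.maximalMonotone ε ⟨hpos, hε.2⟩)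
      h0 hl hαl hx

/-! ### Continuity of the resolvents in `ε`. -/

omit [CompleteSpace H] in
theorem IsMaximalMonotone.exists_perturbedResolvent_eq {m : ℕ} {α : ℕ → ℝ}
    (hA : IsMaximalMonotone A) (hAG : StandingAssumption A G m α) {l : ℝ} {ε : ℝ}
    (hε : ε ∈ Icc (0 : ℝ) 1) : ∃ T : H →ₗ.[ℝ] H, IsMaximalMonotone T ∧
      perturbedResolvent A G l ε = resolvent T l ∧
      ∀ x a g, (x, a) ∈ A.graph → (x, g) ∈ G.graph → (x, a + ε • g) ∈ T.graph := by
  by_cases hε0 : ε = 0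
  · refine ⟨A, hA, by rw [perturbedResolvent, if_pos hε0], fun x a g ha hg => ?_⟩
    rwa [hε0, zero_smul, add_zero]
  · have hpos : 0 < ε := lt_of_le_of_ne hε.1 (Ne.symm hε0)
    exact ⟨_, hAG.maximalMonotone ε ⟨hpos, hε.2⟩, by rw [perturbedResolvent, if_neg hε0],
      fun x a g ha hg => mem_graph_closedSum ha hg⟩

theorem IsMaximalMonotone.perturbedResolvent_sub {m : ℕ} {α : ℕ → ℝ}
    (hA : IsMaximalMonotone A) (hAG : StandingAssumption A G m α) {l : ℝ} (hl : 0 < l) {ε : ℝ}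
    (hε : ε ∈ Icc (0 : ℝ) 1) (x y : H) : perturbedResolvent A G l ε (x - y) =
      perturbedResolvent A G l ε x - perturbedResolvent A G l ε y := by
  obtain ⟨T, hT, h, -⟩ := hA.exists_perturbedResolvent_eq (l := l) hAG hε
  rw [h]
  exact map_sub (hT.resolventCLM hl) x y

/-- Here `y = R_l(δ) (l y + a + δ g)`, so the difference is `R_l(δ)` applied to the residual at `ε`
minus `(δ - ε) g`. -/
theorem IsMaximalMonotone.norm_perturbedResolvent_sub_le {m : ℕ} {α : ℕ → ℝ}
    (hA : IsMaximalMonotone A) (hAG : StandingAssumption A G m α) {l : ℝ} (hl : 0 < l) {ε δ : ℝ}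
    (hδ : δ ∈ Icc (0 : ℝ) 1) {x y a g : H} (ha : (y, a) ∈ A.graph) (hg : (y, g) ∈ G.graph) :
    ‖perturbedResolvent A G l δ x - y‖ ≤
      l⁻¹ * (‖x - (l • y + a + ε • g)‖ + |δ - ε| * ‖g‖) := by
  obtain ⟨T, hT, h, hmem⟩ := hA.exists_perturbedResolvent_eq (l := l) hAG hδ
  have h1 := hT.resolvent_eq hl (hmem y a g ha hg)
  have h2 : perturbedResolvent A G l δ x - y = hT.resolventCLM hl
      ((x - (l • y + a + ε • g)) - (δ - ε) • g) := by
    have h3 : (x - (l • y + a + ε • g)) - (δ - ε) • g = x - (l • y + (a + δ • g)) := by module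
    rw [h3, map_sub, hT.resolventCLM_apply, hT.resolventCLM_apply, h1, h]
  rw [h2]
  refine (hT.norm_resolvent_le hl _).trans (mul_le_mul_of_nonneg_left ?_ (inv_pos.2 hl).le)
  refine (norm_sub_le _ _).trans (le_of_eq ?_)
  rw [norm_smul, Real.norm_eq_abs]

theorem IsMaximalMonotone.tendsto_perturbedResolvent_of_approx {m : ℕ} {α : ℕ → ℝ}
    (hA : IsMaximalMonotone A) (hAG : StandingAssumption A G m α) {l : ℝ} (hl : 0 < l) {ε : ℝ}
    (hε : ε ∈ Icc (0 : ℝ) 1) {x : H} (h : ∀ η > 0, ∃ y a g, (y, a) ∈ A.graph ∧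
      (y, g) ∈ G.graph ∧ ‖x - (l • y + a + ε • g)‖ < η) :
    Tendsto (fun δ => perturbedResolvent A G l δ x) (𝓝[Icc 0 1] ε)
      (𝓝 (perturbedResolvent A G l ε x)) := by
  rw [Metric.tendsto_nhdsWithin_nhds]
  intro η hη
  obtain ⟨y, a, g, ha, hg, hlt⟩ := h (l * (η / 4)) (by positivity)
  refine ⟨l * (η / 2) / (‖g‖ + 1), by positivity, fun δ hδ hδε => ?_⟩
  rw [Real.dist_eq, lt_div_iff₀ (by positivity)] at hδε
  have h1 := hA.norm_perturbedResolvent_sub_le (x := x) (ε := ε) hAG hl hδ ha hg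
  have h2 := hA.norm_perturbedResolvent_sub_le (x := x) (ε := ε) hAG hl hε ha hg
  rw [sub_self, abs_zero, zero_mul, add_zero, inv_mul_eq_div, le_div_iff₀' hl] at h2
  rw [inv_mul_eq_div, le_div_iff₀' hl] at h1
  have h3 := norm_sub_le_norm_sub_add_norm_sub (perturbedResolvent A G l δ x) y
    (perturbedResolvent A G l ε x)
  rw [norm_sub_rev y] at h3
  rw [dist_eq_norm]
  refine lt_of_mul_lt_mul_left ?_ hl.le
  have h4 := mul_le_mul_of_nonneg_left h3 hl.le
  linarith [abs_nonneg (δ - ε)]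

theorem IsMaximalMonotone.tendsto_perturbedResolvent_of_pos {m : ℕ} {α : ℕ → ℝ}
    (hA : IsMaximalMonotone A) (hAG : StandingAssumption A G m α) {l : ℝ} (hl : 0 < l) {ε : ℝ}
    (hε : ε ∈ Ioc (0 : ℝ) 1) (x : H) :
    Tendsto (fun δ => perturbedResolvent A G l δ x) (𝓝[Icc 0 1] ε)
      (𝓝 (perturbedResolvent A G l ε x)) := by
  refine hA.tendsto_perturbedResolvent_of_approx hAG hl ⟨hε.1.le, hε.2⟩ fun η hη => ?_
  obtain ⟨w, a, g, ha, hg, h1, h2⟩ := exists_mem_graph_of_mem_closedSum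
    ((hAG.maximalMonotone ε hε).resolvent_mem_graph hl x) (div_pos hη (by positivity : 0 < l + 1))
  refine ⟨w, a, g, ha, hg, ?_⟩
  set r := resolvent (closedSum A G ε) l x
  have h3 : x - (l • w + a + ε • g) = l • (r - w) + (x - l • r - (a + ε • g)) := by module
  rw [h3]
  refine (norm_add_le _ _).trans_lt ?_
  rw [norm_smul, Real.norm_of_nonneg hl.le]
  have h4 : (l + 1) * (η / (l + 1)) = η := mul_div_cancel₀ _ (by positivity)
  nlinarith

theorem IsMaximalMonotone.tendsto_perturbedResolvent {m : ℕ} {α : ℕ → ℝ}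
    (hA : IsMaximalMonotone A) (hG : IsMaximalMonotone G) (hAG : StandingAssumption A G m α)
    {k : ℕ} (hk : k ∈ Icc 1 (m + 1)) {l : ℝ} (hl : 0 < l) (hαl : α k < l) {ε : ℝ}
    (hε : ε ∈ Icc (0 : ℝ) 1) {x : H} (hx : x ∈ closure ((opPow G k).domain : Set H)) :
    Tendsto (fun δ => perturbedResolvent A G l δ x) (𝓝[Icc 0 1] ε)
      (𝓝 (perturbedResolvent A G l ε x)) := by
  rcases hε.1.eq_or_lt with rfl | hpos
  -- At `ε = 0`, approximate `x` by `w` in `D(G ^ k)` and take `y = R_l(0) w`: it lies in `D(A) ∩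
  -- D(G)` since `k ≥ 1`, and its residual is exactly `x - w`.
  · refine hA.tendsto_perturbedResolvent_of_approx hAG hl hε fun η hη => ?_
    obtain ⟨w, hw, hxw⟩ := Metric.mem_closure_iff.1 hx η hη
    obtain ⟨z, hz⟩ := LinearPMap.mem_domain_iff.1 hw
    obtain ⟨v, hv, -⟩ := hA.perturbedResolvent_mem_powBall hG hAG hk hl hαl hε
      (⟨z, hz, le_rfl⟩ : w ∈ powBall G k ‖z‖)
    rw [perturbedResolvent, if_pos rfl] at hv
    obtain ⟨g, hg⟩ := LinearPMap.mem_domain_iff.1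
      (opPow_domain_anti G hk.1 (LinearPMap.mem_domain_of_mem_graph hv))
    refine ⟨_, _, g, hA.resolvent_mem_graph hl w, mem_graph_opPow_one.1 hg, ?_⟩
    rwa [zero_smul, add_zero, add_sub_cancel, ← dist_eq_norm]
  · exact hA.tendsto_perturbedResolvent_of_pos hAG hl ⟨hpos, hε.2⟩ x

/-- Regularising `x` gains one power of `G`: the resolvents of the regularised vector are bounded in
`D(G ^ (k + 1))`, and interpolation against their convergence in `H` controls `G ^ k`. This is where
the bound of order `k + 1` enters. -/
theorem IsMaximalMonotone.eventually_perturbedResolvent_sub_mem_powBall {m : ℕ} {α : ℕ → ℝ}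
    (hA : IsMaximalMonotone A) (hG : IsMaximalMonotone G) (hAG : StandingAssumption A G m α)
    {k : ℕ} (hk : k ∈ Icc 1 m) {l : ℝ} (hl : 0 < l) (hαl : max (α k) (α (k + 1)) < l) {ε : ℝ}
    (hε : ε ∈ Icc (0 : ℝ) 1) {x : H} (hx : x ∈ (opPow G k).domain) {η : ℝ} (hη : 0 < η) :
    ∀ᶠ δ in 𝓝[Icc 0 1] ε,
      perturbedResolvent A G l δ x - perturbedResolvent A G l ε x ∈ powBall G k η := by
  obtain ⟨hα, hα'⟩ := max_lt_iff.1 hαl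
  have hk0 : k ∈ Icc 1 (m + 1) := ⟨hk.1, hk.2.trans m.le_succ⟩
  have hk1 : k + 1 ∈ Icc 1 (m + 1) := ⟨k.succ_pos, Nat.succ_le_succ hk.2⟩
  have hpos : 0 < l - α k := sub_pos.2 hα
  obtain ⟨z, hz⟩ := LinearPMap.mem_domain_iff.1 hx
  obtain ⟨δ₀, hδ₀, hlt⟩ := hG.exists_norm_contr_sub_lt z
    (by positivity : 0 < (l - α k) * (η / 4))
  have hh : 0 < δ₀ / 2 := half_pos hδ₀
  have hzlt := hlt _ hh (half_lt_self hδ₀)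
  set x' := hG.contr hh x
  have hx' : (x', hG.contr hh z) ∈ (opPow G k).graph := hG.contr_mem_graph_opPow hh hz
  have hsub : x - x' ∈ powBall G k ((l - α k) * (η / 4)) :=
    ⟨z - hG.contr hh z, sub_mem hz hx', by rw [norm_sub_rev]; exact hzlt.le⟩
  have hsubR : ∀ δ ∈ Icc (0 : ℝ) 1,
      perturbedResolvent A G l δ x - perturbedResolvent A G l δ x' ∈ powBall G k (η / 4) := by
    intro δ hδ
    have h1 := hA.perturbedResolvent_mem_powBall hG hAG hk0 hl hα hδ hsub
    rwa [inv_mul_cancel_left₀ hpos.ne', hA.perturbedResolvent_sub hAG hl hδ] at h1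
  have hxs : x' ∈ powBall G (k + 1) ‖hG.yosida hh z‖ :=
    ⟨_, mem_graph_opPow_succ.2 ⟨_, hx', hG.contr_mem_graph hh z⟩, le_rfl⟩
  have hR : ∀ δ ∈ Icc (0 : ℝ) 1, perturbedResolvent A G l δ x' ∈
      powBall G (k + 1) ((l - α (k + 1))⁻¹ * ‖hG.yosida hh z‖) := fun δ hδ =>
    hA.perturbedResolvent_mem_powBall hG hAG hk1 hl hα' hδ hxs
  set M := (l - α (k + 1))⁻¹ * ‖hG.yosida hh z‖
  have hM : 0 ≤ M := mul_nonneg (inv_pos.2 (sub_pos.2 hα')).le (norm_nonneg _)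
  -- The difference of two resolvents has `G ^ (k + 1)`-norm at most `2 M`, so this weight
  -- contributes at most `η / 4`; convergence in `H` provides another `η / 4`.
  obtain ⟨D, hD, hint⟩ := hG.exists_interpolation k (δ := η / (8 * (M + 1))) (by positivity)
  have hlim := hA.tendsto_perturbedResolvent hG hAG hk0 hl hα hε
    (subset_closure (LinearPMap.mem_domain_of_mem_graph hx'))
  rw [tendsto_iff_norm_sub_tendsto_zero] at hlim
  filter_upwards [hlim.eventually_lt_const (by positivity : 0 < η / 4 / D),
    self_mem_nhdsWithin] with δ hδ hmem
  rw [lt_div_iff₀ hD] at hδ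
  obtain ⟨v, hv, hvM⟩ := sub_mem_powBall (hR δ hmem) (hR ε hε)
  obtain ⟨u, hu, huv⟩ := mem_graph_opPow_succ.1 hv
  have h1 := hint _ u v hu huv
  have h2 : η / (8 * (M + 1)) * ‖v‖ ≤ η / 4 := by
    have h3 : η / (8 * (M + 1)) * (2 * (M + 1)) = η / 4 := by field_simp; norm_num
    rw [← h3]
    refine mul_le_mul_of_nonneg_left ?_ (by positivity)
    linarith
  have h3 : perturbedResolvent A G l δ x' - perturbedResolvent A G l ε x' ∈ powBall G k (η / 2) :=
    ⟨u, hu, by linarith⟩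
  have h4 := add_mem_powBall (sub_mem_powBall (hsubR δ hmem) (hsubR ε hε)) h3
  have h5 : η / 4 + η / 4 + η / 2 = η := by ring
  rw [h5] at h4
  convert h4 using 1
  abel

end ResolventBounds

/-! ### The norm of `D(G ^ k)`. -/

section PowDomainNorm

variable {H : Type*} [NormedAddCommGroup H] [InnerProductSpace ℝ H] {G : H →ₗ.[ℝ] H}

theorem PowDomain.norm_sq_eq {k : ℕ} (z : PowDomain G k) :
    ‖z‖ ^ 2 = ∑ j : Fin (k + 1), ‖PowDomain.powMap j z‖ ^ 2 := by
  rw [← real_inner_self_eq_norm_sq]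
  exact Finset.sum_congr rfl fun j _ => real_inner_self_eq_norm_sq _

theorem PowDomain.norm_le_sum {k : ℕ} (z : PowDomain G k) :
    ‖z‖ ≤ ∑ j : Fin (k + 1), ‖PowDomain.powMap j z‖ := by
  refine le_of_sq_le_sq ?_ (Finset.sum_nonneg fun j _ => norm_nonneg _)
  rw [PowDomain.norm_sq_eq]
  exact Finset.sum_sq_le_sq_sum_of_nonneg fun j _ => norm_nonneg _

/-- The intermediate powers are bounded by `‖x‖ + ‖G ^ k x‖`, so convergence in `D(G ^ k)` need only
be checked on `x` and `G ^ k x`. -/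
theorem IsMaximalMonotone.exists_norm_powDomain_le [CompleteSpace H] (hG : IsMaximalMonotone G)
    (k : ℕ) : ∃ C > 0, ∀ (x : H) (hx : x ∈ (opPow G k).domain) (η : ℝ), ‖x‖ ≤ η →
      x ∈ powBall G k η → ‖(PowDomain.mk x hx : PowDomain G k)‖ ≤ C * η := by
  choose C hC hle using fun j : Fin (k + 1) => hG.exists_norm_le_of_le (Nat.lt_succ_iff.1 j.2)
  refine ⟨(∑ j, C j) * 2, mul_pos (Finset.sum_pos (fun j _ => hC j) Finset.univ_nonempty) two_pos,
    fun x hx η hxη hball => ?_⟩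
  obtain ⟨z, hz, hzη⟩ := hball
  refine (PowDomain.norm_le_sum _).trans ?_
  rw [Finset.sum_mul, Finset.sum_mul]
  refine Finset.sum_le_sum fun j _ => ?_
  have h1 : (x, PowDomain.powMap j (PowDomain.mk x hx : PowDomain G k)) ∈ (opPow G j).graph :=
    LinearPMap.mem_graph (opPow G j) ⟨x, opPow_domain_anti G (Nat.lt_succ_iff.1 j.2) hx⟩
  refine (hle j x _ z h1 hz).trans ?_
  rw [mul_assoc]
  exact mul_le_mul_of_nonneg_left (by linarith) (hC j).le

end PowDomainNorm

end MonotoneOp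

/-! ### Passage from increments `h` to nearby parameters, and the main theorem. -/

theorem tendsto_const_add_comap_nhdsWithin {s : Set ℝ} (ε : ℝ) :
    Tendsto (fun h : {h : ℝ // ε + h ∈ s} => ε + (h : ℝ)) (comap Subtype.val (𝓝 0)) (𝓝[s] ε) := by
  refine tendsto_nhdsWithin_iff.2 ⟨?_, Eventually.of_forall fun h => h.2⟩
  have h1 : Tendsto (fun h : ℝ => ε + h) (𝓝 0) (𝓝 ε) := by
    have := (continuous_const_add ε).tendsto 0
    rwa [add_zero] at this
  exact h1.comp tendsto_comap

theorem mainTheorem8 {H : Type*} [NormedAddCommGroup H] [InnerProductSpace ℝ H] [CompleteSpace H]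
    (A G : H →ₗ.[ℝ] H) (hA : IsMaximalMonotone A) (hG : IsMaximalMonotone G)
    (m : ℕ) (hm : 1 ≤ m) (α : ℕ → ℝ) (hAG : StandingAssumption A G m α) :
    (∀ l : ℝ, 0 < l → α 1 < l → ∀ ε ∈ Icc (0 : ℝ) 1, ∀ x : H,
      Tendsto (fun h : {h : ℝ // ε + h ∈ Icc (0 : ℝ) 1} => perturbedResolvent A G l (ε + h) x)
        (comap Subtype.val (𝓝 0)) (𝓝 (perturbedResolvent A G l ε x))) ∧
    (∀ k ∈ Icc 1 m, ∀ l : ℝ, 0 < l → max (α k) (α (k + 1)) < l →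
      ∃ hmem : ∀ δ ∈ Icc (0 : ℝ) 1, ∀ x ∈ (opPow G k).domain,
          perturbedResolvent A G l δ x ∈ (opPow G k).domain,
        ∀ ε, ∀ hε : ε ∈ Icc (0 : ℝ) 1, ∀ x, ∀ hx : x ∈ (opPow G k).domain,
          Tendsto (fun h : {h : ℝ // ε + h ∈ Icc (0 : ℝ) 1} =>
              (PowDomain.mk (perturbedResolvent A G l (ε + h) x) (hmem _ h.2 x hx) :
                PowDomain G k))
            (comap Subtype.val (𝓝 0))
            (𝓝 (PowDomain.mk (perturbedResolvent A G l ε x) (hmem ε hε x hx)))) := by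
  constructor
  · intro l hl hα ε hε x
    have hx : x ∈ closure ((opPow G 1).domain : Set H) := by
      refine closure_mono (fun y hy => ?_) (hG.dense_domain x)
      obtain ⟨z, hz⟩ := LinearPMap.mem_domain_iff.1 hy
      exact LinearPMap.mem_domain_of_mem_graph (mem_graph_opPow_one.2 hz)
    exact (hA.tendsto_perturbedResolvent hG hAG ⟨le_rfl, Nat.le_add_left 1 m⟩ hl hα hε hx).comp
      (tendsto_const_add_comap_nhdsWithin ε)
  · intro k hk l hl hαl
    have hα : α k < l := (le_max_left _ _).trans_lt hαl
    have hk0 : k ∈ Icc 1 (m + 1) := ⟨hk.1, hk.2.trans m.le_succ⟩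
    have hmem : ∀ δ ∈ Icc (0 : ℝ) 1, ∀ x ∈ (opPow G k).domain,
        perturbedResolvent A G l δ x ∈ (opPow G k).domain := by
      intro δ hδ x hx
      obtain ⟨z, hz⟩ := LinearPMap.mem_domain_iff.1 hx
      obtain ⟨v, hv, -⟩ := hA.perturbedResolvent_mem_powBall hG hAG hk0 hl hα hδ
        (⟨z, hz, le_rfl⟩ : x ∈ powBall G k ‖z‖)
      exact LinearPMap.mem_domain_of_mem_graph hv
    refine ⟨hmem, fun ε hε x hx => ?_⟩
    obtain ⟨C, hC, hle⟩ := hG.exists_norm_powDomain_le k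
    rw [Metric.tendsto_nhds]
    intro η hη
    have hη' : 0 < η / 2 / C := by positivity
    have h1 := hA.tendsto_perturbedResolvent hG hAG hk0 hl hα hε (subset_closure hx)
    rw [tendsto_iff_norm_sub_tendsto_zero] at h1
    have h2 := (h1.eventually_lt_const hη').and
      (hA.eventually_perturbedResolvent_sub_mem_powBall hG hAG hk hl hαl hε hx hη')
    filter_upwards [(tendsto_const_add_comap_nhdsWithin ε).eventually h2] with h hh
    have h3 := hle _ (sub_mem (hmem _ h.2 x hx) (hmem ε hε x hx)) _ hh.1.le hh.2
    rw [mul_div_cancel₀ _ hC.ne'] at h3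
    rw [dist_eq_norm]
    exact h3.trans_lt (half_lt_self hη)
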